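/- **Words.** Fix $d\ge 1$ and the letters $\pi_i,\pi_i^{-1}$ ($1\le i\le d$), of sign $+1$ and $-1$ respectively. Let $\mathcal W'$ be the set of cyclically reduced words of length at least one, where words that differ by rotation and inversion are identified. For $w=w_1\cdots w_k\in\mathcal W'$ (indices modulo $k$) let $|w|=k$; let $h(w)$ be the largest $m$ such that $w=u^m$ for some word $u$; let $b(w)$ be the number of $i$ such that $w_i$ and $w_{i+1}$ have the same sign; let $c(w)$ be the number of $i$ with $w_i=w_{i+1}$ if $k\ge 2$, and $c(w)=0$ if $k=1$. Doubling the $i$th letter replaces $w_i$ by $w_iw_i$; if $k\ge2$ and $w_i=w_{i+1}$, halving this pair erases one of its two letters. **Chains.** The halving chain is the RCLL Markov chain on $\mathcal W'\cup\{\Delta\}$ ($\Delta$ absorbing) that jumps from $w$ to $u$ at rate $j$ if $u$ is obtained from $w$ by halving $j$ different pairs, and from $w$ to $\Delta$ at rate $|w|-c(w)$. The doubling chain is the RCLL Markov chain on $\mathcal W'$ that jumps from $u$ to $w$ at rate $a$ if $w$ is obtained from $u$ by doubling $a$ different letters. **Point processes.** Let $\chi$ be a Poisson point process on $(-\infty,\infty)\times[0,\infty)\times\mathcal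 W'$ whose intensity on $(-\infty,\infty)\times[0,\infty)\times\{w\}$ is $\frac{2b(w)}{h(w)}$ times the product of Lebesgue measure and the exponential law of rate $2b(w)$ (no atoms if $b(w)=0$). Given $\chi$, let independent halving chains start from the words of its atoms. For $t\le 0$ let $\chi(t)$ be the point process with one atom $(z,v,\bar w)$ for every atom $(z,v,w)$ of $\chi$ whose halving chain is at $\bar w\in\mathcal W'$ at time $-t$ (atoms whose chain is then at $\Delta$ are discarded). **Proposition.** For every $t\le0$, $\chi(t)$ is a Poisson point process on $(-\infty,\infty)\times[0,\infty)\times\mathcal W'$. Its intensity measure has a density, not depending on the birth time $z$, with respect to the product of Lebesgue measure on $(-\infty,\infty)\times[0,\infty)$ and counting measure on $\mathcal W'$. For every Borel set $B\subseteq\mathbb R$, $v\ge0$ and $\bar w\in\mathcal W'$, the intensity of $B\times[v,\infty)\times\{\bar w\}$ is $\mathrm{Leb}(B)\,r_t(v,\bar w)$, where $$r_t(v,\bar w)=\frac{2}{h(\bar w)}\,\mathrm E_{\bar w}\!\left[b(Y_t)\,e^{-2b(Y_t)v}\right]$$ and $Y_t$ is the state at time $-t$ of the doubling chain started from $\bar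 w$ (the expectation is that of an integrable random variable). In particular the birth rate of atoms with word $\bar w$ is, at every time, $$r_t(0,\bar w)=\frac{2}{h(\bar w)}\left(b(\bar w)-|\bar w|+e^{-t}|\bar w|\right).$$ -/

import Mathlib

open MeasureTheory ProbabilityTheory
open scoped NNReal ENNReal

namespace CycleField

/-! ### Words and their classes -/

/-- Letters: `(i, true)` stands for `π_i` and `(i, false)` for its inverse; the second
coordinate is the sign of the letter. -/
abbrev Letter (d : ℕ) := Fin d × Bool

/-- Two lists of letters that differ only by a rotation and possibly an inversion
(`FreeGroup.invRev` reverses the list and inverts every letter). -/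
def DihedralEquiv {d : ℕ} (L L' : List (Letter d)) : Prop :=
  L ~r L' ∨ L ~r FreeGroup.invRev L'

theorem invRev_isRotated {d : ℕ} {L L' : List (Letter d)} (h : L ~r L') :
    FreeGroup.invRev L ~r FreeGroup.invRev L' :=
  (h.map _).reverse

theorem dihedralEquiv_equivalence (d : ℕ) :
    Equivalence (DihedralEquiv : List (Letter d) → List (Letter d) → Prop) where
  refl L := Or.inl (List.IsRotated.refl L)
  symm := by
    rintro L L' (h | h)
    · exact Or.inl h.symm
    · refine Or.inr ?_
      have h1 := invRev_isRotated h
      rw [FreeGroup.invRev_invRev] at h1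
      exact h1.symm
  trans := by
    rintro L L' L'' (h | h) (h' | h')
    · exact Or.inl (h.trans h')
    · exact Or.inr (h.trans h')
    · exact Or.inr (h.trans (invRev_isRotated h'))
    · refine Or.inl ?_
      have h1 := invRev_isRotated h'
      rw [FreeGroup.invRev_invRev] at h1
      exact h.trans h1

/-- Cyclically reduced words of positive length in `π_1^{±1}, …, π_d^{±1}`. -/
def Word (d : ℕ) : Type :=
  {L : List (Letter d) // L ≠ [] ∧ FreeGroup.IsCyclicallyReduced L}

instance wordSetoid (d : ℕ) : Setoid (Word d) where
  r w w' := DihedralEquiv w.1 w'.1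
  iseqv :=
    { refl := fun w => (dihedralEquiv_equivalence d).refl w.1
      symm := fun h => (dihedralEquiv_equivalence d).symm h
      trans := fun h h' => (dihedralEquiv_equivalence d).trans h h' }

/-- The set `𝒲'` of cyclically reduced words of length at least one, up to rotation and
inversion. -/
def WordClass (d : ℕ) : Type := Quotient (wordSetoid d)

/-- `𝒲'` is a countable discrete space. -/
instance (d : ℕ) : MeasurableSpace (WordClass d) := ⊤

namespace WordClass

variable {d : ℕ}

/-- A chosen representative `w_1 ⋯ w_k` of the class. The quantities below do not depend on
the choice, since they are invariant under rotation and inversion. -/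
noncomputable def rep (w : WordClass d) : List (Letter d) := (Quotient.out w).1

/-- The length `|w|`. -/
noncomputable def len (w : WordClass d) : ℕ := w.rep.length

/-- `h(w)`: the largest `m` such that `w = u ^ m` for some word `u`. -/
noncomputable def h (w : WordClass d) : ℕ :=
  sSup {m : ℕ | ∃ u : List (Letter d), w.rep = (List.replicate m u).flatten}

/-- `b(w)`: the number of positions `i` modulo `|w|` such that the letter at `i + 1` has the
same sign as the letter at `i`. -/
noncomputable def b (w : WordClass d) : ℕ :=
  ((Finset.range w.len).filter fun i =>
    w.rep[i]?.map Prod.snd = w.rep[(i + 1) % w.len]?.map Prod.snd).card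

/-- The letters at positions `i` and `i + 1` (modulo `|w|`) form a pair of double letters that
can be halved. A word of length one has no such pair. -/
def IsDoublePair (w : WordClass d) (i : ℕ) : Prop :=
  2 ≤ w.len ∧ w.rep[i]? = w.rep[(i + 1) % w.len]?

open Classical in
/-- `c(w)`: the number of pairs of double letters. -/
noncomputable def c (w : WordClass d) : ℕ :=
  ((Finset.range w.len).filter fun i => w.IsDoublePair i).card

open Classical in
/-- The number of letters of `u` whose doubling produces `w`: for a list `u_0 ⋯ u_{k-1}`,
doubling the letter `u_i` gives `u_0 ⋯ u_i u_i ⋯ u_{k-1}`. -/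
noncomputable def doublingCount (u w : WordClass d) : ℕ :=
  ((Finset.range u.len).filter fun i =>
    DihedralEquiv (u.rep.take (i + 1) ++ u.rep.drop i) w.rep).card

open Classical in
/-- The number of pairs of double letters of `w` whose halving (erasing one of the two
letters) produces `u`. -/
noncomputable def halvingCount (w u : WordClass d) : ℕ :=
  ((Finset.range w.len).filter fun i =>
    w.IsDoublePair i ∧ DihedralEquiv (w.rep.eraseIdx i) u.rep).card

end WordClass

/-- Jump rates of the doubling chain on `𝒲'`. -/
noncomputable def doublingRate {d : ℕ} (u w : WordClass d) : ℝ≥0∞ := (u.doublingCount w : ℝ≥0∞)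

/-- Jump rates of the halving chain on `𝒲' ∪ {Δ}`, where `none` is the (absorbing) cemetery
`Δ`. -/
noncomputable def halvingRate {d : ℕ} : Option (WordClass d) → Option (WordClass d) → ℝ≥0∞
  | some w, some u => (w.halvingCount u : ℝ≥0∞)
  | some w, none => ((w.len - w.c : ℕ) : ℝ≥0∞)
  | none, _ => 0

/-! ### Continuous time Markov chains on a countable state space -/

section Chain

variable {S : Type*}

/-- Total rate at which a chain with jump rates `q` (from a state to a different one)
leaves `x`. -/
noncomputable def exitRate (q : S → S → ℝ≥0∞) (x : S) : ℝ≥0∞ := ∑' y, q x y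

open Classical in
/-- The probability that the chain with jump rates `q` started from `x` is at `y` at time `t`
after exactly `n` jumps, by conditioning on the first jump: the chain holds at `x` for an
exponential time of parameter `exitRate q x`, then jumps to `z` at rate `q x z`. -/
noncomputable def jumpProb (q : S → S → ℝ≥0∞) : ℕ → ℝ → S → S → ℝ≥0∞
  | 0, t, x, y => if x = y then ENNReal.ofReal (Real.exp (-(exitRate q x).toReal * t)) else 0
  | n + 1, t, x, y => ∫⁻ s in Set.Icc 0 t,
      ENNReal.ofReal (Real.exp (-(exitRate q x).toReal * s)) *
        ∑' z, q x z * jumpProb q n (t - s) z y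

/-- The (minimal) transition function of the chain with jump rates `q`. -/
noncomputable def transProb (q : S → S → ℝ≥0∞) (t : ℝ) (x y : S) : ℝ≥0∞ :=
  ∑' n, jumpProb q n t x y

/-- For `l = [(s₁, y₁), …, (sₘ, yₘ)]`: the path `f` is at `y₁` at time `a + s₁`, at `y₂` at time
`a + s₁ + s₂`, and so on. -/
def Visits (f : ℝ≥0 → S) : ℝ≥0 → List (ℝ≥0 × S) → Prop
  | _, [] => True
  | a, (s, y) :: l => f (a + s) = y ∧ Visits f (a + s) l

/-- The finite dimensional distributions of the chain with jump rates `q` started from `x`: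
for `l = [(s₁, y₁), …, (sₘ, yₘ)]`, the product
`p_{s₁}(x, y₁) p_{s₂}(y₁, y₂) ⋯ p_{sₘ}(y_{m-1}, yₘ)`. -/
noncomputable def visitProb (q : S → S → ℝ≥0∞) : S → List (ℝ≥0 × S) → ℝ≥0∞
  | _, [] => 1
  | x, (s, y) :: l => transProb q s x y * visitProb q y l

/-- Right-continuous paths with left limits, in a discrete state space. -/
def IsRCLL (f : ℝ≥0 → S) : Prop :=
  ∀ u : ℝ≥0, (∀ᶠ r in nhdsWithin u (Set.Ioi u), f r = f u) ∧
    ∃ y, ∀ᶠ r in nhdsWithin u (Set.Iio u), f r = y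

/-- Under `P`, the process `Y` is the time homogeneous Markov chain with RCLL paths, jump
rates `q` and starting state `x`. -/
structure IsMarkovChain {Ω : Type*} [MeasurableSpace Ω] (P : Measure Ω) (q : S → S → ℝ≥0∞)
    (x : S) (Y : ℝ≥0 → Ω → S) : Prop where
  measurable : ∀ u y, MeasurableSet {ω | Y u ω = y}
  rcll : ∀ᵐ ω ∂P, IsRCLL fun u => Y u ω
  law : ∀ l : List (ℝ≥0 × S), P {ω | Visits (fun u => Y u ω) 0 l} = visitProb q x l

end Chain

/-! ### Poisson point processes -/

/-- The Poisson distribution of mean `m`, on `[0, ∞]`; it is the unit mass at `∞` if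
`m = ∞`. -/
noncomputable def poissonLaw (m : ℝ≥0∞) : Measure ℝ≥0∞ :=
  if m = ∞ then Measure.dirac ∞
  else (poissonMeasure m.toNNReal).map fun n : ℕ => (n : ℝ≥0∞)

/-- The random measure `N` (in the uses below, a random sum of unit point masses) is a Poisson
point process with intensity measure `Λ`. -/
structure IsPoissonPointProcess {Ω E : Type*} [MeasurableSpace Ω] [MeasurableSpace E]
    (P : Measure Ω) (N : Ω → Measure E) (Λ : Measure E) : Prop where
  measurable : ∀ B, MeasurableSet B → Measurable fun ω => N ω B
  law : ∀ B, MeasurableSet B → P.map (fun ω => N ω B) = poissonLaw (Λ B)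
  indep : ∀ B : ℕ → Set E, (∀ i, MeasurableSet (B i)) → Pairwise (fun i j => Disjoint (B i) (B j)) →
    iIndepFun (fun i ω => N ω (B i)) P

/-! ### The limiting process -/

/-- The space `(-∞, ∞) × [0, ∞) × 𝒲'` of triples (birth time, lifetime, word). -/
abbrev Atom (d : ℕ) := ℝ × ℝ≥0 × WordClass d

/-- The intensity measure of `χ`: on the atoms with word `w` it is the product of Lebesgue
measure, the exponential law of rate `2 b(w)` and the mass `2 b(w) / h(w)` at `w`. -/
noncomputable def chiIntensity (d : ℕ) : Measure (Atom d) :=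
  Measure.sum fun w : WordClass d =>
    (volume : Measure ℝ).prod
      (((expMeasure (2 * w.b)).comap ((↑) : ℝ≥0 → ℝ)).prod
        (ENNReal.ofReal (2 * w.b / w.h) • Measure.dirac w))

/-- The sequence `ξ` enumerates the atoms of the Poisson point process `χ`, and, given `ξ`, the
processes `X n` are independent halving chains, `X n` starting from the word of `ξ n`. -/
structure IsLimitingProcess {d : ℕ} {Ω : Type*} [MeasurableSpace Ω] (P : Measure Ω)
    (ξ : ℕ → Ω → Atom d) (X : ℕ → ℝ≥0 → Ω → Option (WordClass d)) : Prop where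
  measurable_atom : ∀ n, Measurable (ξ n)
  poisson : IsPoissonPointProcess P (fun ω => Measure.sum fun n => Measure.dirac (ξ n ω))
    (chiIntensity d)
  measurable_chain : ∀ n u y, MeasurableSet {ω | X n u ω = y}
  rcll : ∀ n, ∀ᵐ ω ∂P, IsRCLL fun u => X n u ω
  law : ∀ (A : Set (ℕ → Atom d)), MeasurableSet A → ∀ (I : Finset ℕ)
    (l : ℕ → List (ℝ≥0 × Option (WordClass d))),
    P {ω | (fun n => ξ n ω) ∈ A ∧ ∀ n ∈ I, Visits (fun u => X n u ω) 0 (l n)} =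
      ∫⁻ ω in {ω | (fun n => ξ n ω) ∈ A}, ∏ n ∈ I,
        visitProb halvingRate (some (ξ n ω).2.2) (l n) ∂P

/-- The point process `χ(t)`: every atom `(z, v, w)` whose halving chain is at a word `w̄` (and
not at `Δ`) at time `-t` contributes a unit mass at `(z, v, w̄)`. -/
noncomputable def chiAt {d : ℕ} {Ω : Type*} (ξ : ℕ → Ω → Atom d)
    (X : ℕ → ℝ≥0 → Ω → Option (WordClass d)) (t : ℝ) (ω : Ω) : Measure (Atom d) :=
  Measure.sum fun n =>
    match X n (-t).toNNReal ω with
    | some w' => Measure.dirac ((ξ n ω).1, (ξ n ω).2.1, w')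
    | none => 0

/-- The product of Lebesgue measure on `(-∞, ∞) × [0, ∞)` and the counting measure on
`𝒲'`. -/
noncomputable def refMeasure (d : ℕ) : Measure (Atom d) :=
  (volume : Measure ℝ).prod
    (((volume : Measure ℝ).comap ((↑) : ℝ≥0 → ℝ)).prod Measure.count)

/-- `r_t(v, w̄) = (2 / h(w̄)) E_{w̄} (b(Y_t) exp (-2 b(Y_t) v))`, where under `Q w̄` the process `Y`
starts from `w̄`, and `Y_t` is its state at time `-t`. -/
noncomputable def rate {d : ℕ} {Ω : Type*} [MeasurableSpace Ω] (Q : WordClass d → Measure Ω)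
    (Y : ℝ≥0 → Ω → WordClass d) (t v : ℝ) (w : WordClass d) : ℝ :=
  2 / w.h * ∫ ω, ((Y (-t).toNNReal ω).b : ℝ) *
    Real.exp (-2 * (Y (-t).toNNReal ω).b * v) ∂(Q w)

end CycleField

namespace CycleField

/-! ### Combinatorics of cyclic words -/

section Rotation

variable {α : Type*}

/-! Put `s = -t`. Moving the atoms of a Poisson process by independent kernels, and deleting those
sent to `Δ`, yields a Poisson process whose intensity is the moved intensity. At lifetimes in `[v,
∞)` and word `w̄` the intensity is therefore `∑ w, (2 b(w) / h(w)) e^{-2 b(w) v} p_s(w, w̄)`, with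
`p_s` the transition function of the halving chain. The rest is a time reversal: `h(w̄) p_s(w, w̄) =
h(w) q_s(w̄, w)`, with `q_s` that of the doubling chain (`transProb_duality`). Substituting it turns
the sum into an expectation over the doubling chain started from `w̄` (`ofReal_rate`).

The reversal has two ingredients. The rates satisfy detailed balance with weights `h`
(`WordClass.h_mul_halvingCount`): positions in a word count each distinct rotation `h` times, and
the remaining counts of distinct rotations agree by `ncard_doubling_eq`, because no nonempty reduced
word is a rotation of its inverse. Moreover both chains leave a word `w` at total rate `|w|`; the
killing rate `|w| - c(w)` is what makes this so. Every jump changes the length by one, so the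
probability of `n` jumps is a product of rates along paths times a factor `jumpWeight` depending
only on `n`, the smaller length and the time, and this factor is the same for both chains.

The Poisson property is proved by Laplace functionals. These characterize Poisson processes
(`isPoissonPointProcess_of_laplace`), and integrating out the marks computes the functional of the
moved process (`IsMarking.lintegral_expNeg`). Functions take values in `[0, ∞]` throughout, so
finiteness of the intensity plays no role.

For the birth rate, `b - |·|` is constant along doublings and `|Y|` is a Yule process, whose mean is
`e^s |w̄|`. -/

theorem iterate_rotate_one (L : List α) (n : ℕ) :
    (fun M : List α => M.rotate 1)^[n] L = L.rotate n := by
  induction n with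
  | zero => simp
  | succ n ih => rw [Function.iterate_succ_apply', ih, List.rotate_rotate]

theorem flatten_replicate_rotate (u : List α) (m : ℕ) :
    (List.replicate m u).flatten.rotate u.length = (List.replicate m u).flatten := by
  cases m with
  | zero => simp
  | succ m =>
    rw [List.replicate_succ, List.flatten_cons, List.rotate_append_length_eq]
    rw [← List.flatten_cons, ← List.replicate_succ, List.replicate_succ']
    simp

theorem eq_flatten_replicate_of_rotate (D : ℕ) : ∀ (m : ℕ) (L : List α), L.length = D * m →
    L.rotate D = L → L = (List.replicate m (L.take D)).flatten := by
  intro m L hL hr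
  rcases Nat.eq_zero_or_pos m with rfl | hm
  · have : L = [] := List.length_eq_zero_iff.1 (by simpa using hL)
    simp [this]
  have hDL : D ≤ L.length := by rw [hL]; exact Nat.le_mul_of_pos_right _ hm
  have hr' : L.drop D ++ L.take D = L := by
    rwa [List.rotate_eq_drop_append_take hDL] at hr
  have key : ∀ j, j ≤ m → L.take (D * j) = (List.replicate j (L.take D)).flatten := by
    intro j
    induction j with
    | zero => simp
    | succ j ih =>
      intro hj
      have hlen : D * j + D ≤ L.length := by
        rw [hL, ← Nat.mul_succ]; exact Nat.mul_le_mul_left _ hj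
      -- Dropping the first block leaves a list that again begins like `L`, by the invariance under
      -- rotation by `D`.
      have h1 : L.take (D * j + D) = L.take D ++ L.take (D * j) := by
        have h2 : (L.drop D).take (D * j) = L.take (D * j) := by
          conv_rhs => rw [← hr']
          rw [List.take_append_of_le_length]
          rw [List.length_drop]; omega
        rw [← h2, Nat.add_comm, List.take_add]
      rw [Nat.mul_succ, h1, ih (by omega), List.replicate_succ, List.flatten_cons]
  have := key m le_rfl
  rwa [← hL, List.take_length] at this

/-- The exponent of the largest power that a list is. -/
theorem sSup_exponent (L : List α) (hL : L ≠ []) :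
    sSup {m : ℕ | ∃ u : List α, L = (List.replicate m u).flatten} *
      Function.minimalPeriod (fun M : List α => M.rotate 1) L = L.length := by
  set D := Function.minimalPeriod (fun M : List α => M.rotate 1) L with hD
  have hpos : 0 < L.length := List.length_pos_iff.2 hL
  have hper : ∀ n, L.rotate n = L ↔ D ∣ n := by
    intro n
    rw [← iterate_rotate_one, hD, ← Function.isPeriodicPt_iff_minimalPeriod_dvd]
    rfl
  obtain ⟨m, hm⟩ := (hper L.length).1 (List.rotate_length L)
  have hDpos : 0 < D := Nat.pos_of_ne_zero fun h => by simp [h] at hm; exact hL hm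
  suffices IsGreatest {m : ℕ | ∃ u : List α, L = (List.replicate m u).flatten} m by
    rw [this.csSup_eq, hm, Nat.mul_comm]
  refine ⟨⟨_, eq_flatten_replicate_of_rotate D m L hm ((hper D).2 dvd_rfl)⟩, ?_⟩
  rintro n ⟨u, hu⟩
  have h1 : L.rotate u.length = L := by rw [hu]; exact flatten_replicate_rotate u n
  have h2 : D ≤ u.length := by
    refine Nat.le_of_dvd (Nat.pos_of_ne_zero fun h => hL ?_) ((hper _).1 h1)
    rw [hu, List.length_eq_zero_iff.1 h]; simp
  have h3 : n * u.length = D * m := by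
    rw [← hm]; conv_rhs => rw [hu]
    simp
  by_contra! h4
  have : D * m < n * u.length := by
    calc D * m < D * n := Nat.mul_lt_mul_of_pos_left h4 hDpos
      _ = n * D := Nat.mul_comm _ _
      _ ≤ n * u.length := Nat.mul_le_mul_left _ h2
  omega

theorem count_mul_of_periodic (p : ℕ → Prop) [DecidablePred p] (D : ℕ)
    (hp : ∀ i, p (i + D) ↔ p i) (m : ℕ) : Nat.count p (m * D) = m * Nat.count p D := by
  induction m with
  | zero => simp
  | succ m ih =>
    have h : ∀ i, p (m * D + i) ↔ p i := by
      intro i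
      clear ih
      induction m with
      | zero => simp
      | succ m ihm => rw [← ihm, ← hp (m * D + i)]; ring_nf
    rw [Nat.succ_mul, Nat.count_add, ih, Nat.succ_mul]
    congr 1
    rw [Nat.count_eq_card_filter_range, Nat.count_eq_card_filter_range]
    exact congrArg _ (Finset.filter_congr fun i _ => h i)

open Classical in
-- As `i` runs over one least period, `L.rotate i` meets every rotation exactly once, and the length
-- of `L` contains as many periods as the exponent. This is the source of the factors `h` in the
-- detailed balance.
theorem card_filter_rotate (L : List α) (hL : L ≠ []) (p : List α → Prop) :
    ((Finset.range L.length).filter fun i => p (L.rotate i)).card =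
      sSup {m : ℕ | ∃ u : List α, L = (List.replicate m u).flatten} *
        Set.ncard {M | M ~r L ∧ p M} := by
  have hs := sSup_exponent L hL
  set D := Function.minimalPeriod (fun M : List α => M.rotate 1) L with hD
  have hper : L.rotate D = L := by
    rw [← iterate_rotate_one]; exact Function.isPeriodicPt_minimalPeriod _ _
  have hDpos : 0 < D := Nat.pos_of_ne_zero fun h => by
    simp [h] at hs; exact hL (List.length_eq_zero_iff.1 hs.symm)
  rw [← Nat.count_eq_card_filter_range, ← hs, count_mul_of_periodic _ D]
  · congr 1
    rw [Nat.count_eq_card_filter_range, ← Set.ncard_coe_finset]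
    refine Set.ncard_congr (fun i _ => L.rotate i) ?_ ?_ ?_
    · intro i hi
      simp only [Finset.coe_filter, Finset.mem_range, Set.mem_ofPred_eq] at hi
      exact ⟨List.IsRotated.forall L i, hi.2⟩
    · intro i j hi hj hij
      simp only [Finset.coe_filter, Finset.mem_range, Set.mem_ofPred_eq] at hi hj
      rw [← iterate_rotate_one, ← iterate_rotate_one] at hij
      exact Function.iterate_injOn_Iio_minimalPeriod hi.1 hj.1 hij
    · rintro M ⟨hM, hpM⟩
      obtain ⟨n, rfl⟩ := hM.symm
      have : L.rotate (n % D) = L.rotate n := by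
        rw [← iterate_rotate_one, ← iterate_rotate_one, hD, Function.iterate_mod_minimalPeriod_eq]
      refine ⟨n % D, ?_, this⟩
      simp only [Finset.coe_filter, Finset.mem_range, Set.mem_ofPred_eq]
      exact ⟨Nat.mod_lt _ hDpos, by rwa [this]⟩
  · intro i
    rw [Nat.add_comm, ← List.rotate_rotate, hper]

end Rotation

/-! ### Doubling, inversion and the bijection behind detailed balance -/

section Letters

variable {d : ℕ}

/-- Double the first letter. -/
def dbl : List (Letter d) → List (Letter d)
  | [] => []
  | a :: T => a :: a :: T

/-- Invert a list and rotate the inverse of the first letter to the front. -/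
def flipRev : List (Letter d) → List (Letter d)
  | [] => []
  | a :: T => (a.1, !a.2) :: FreeGroup.invRev T

theorem dbl_injective : Function.Injective (dbl : List (Letter d) → _) := by
  rintro (_ | ⟨a, T⟩) (_ | ⟨b, S⟩) h <;> simp_all [dbl]

theorem flipRev_flipRev (L : List (Letter d)) : flipRev (flipRev L) = L := by
  cases L <;> simp [flipRev, FreeGroup.invRev_invRev]

theorem flipRev_rotated (L : List (Letter d)) : flipRev L ~r FreeGroup.invRev L := by
  cases L with
  | nil => simp [flipRev]
  | cons a T =>
    rw [FreeGroup.invRev_cons]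
    exact (List.isRotated_concat _ _).symm

theorem dbl_flipRev_rotated (L : List (Letter d)) :
    dbl (flipRev L) ~r FreeGroup.invRev (dbl L) := by
  cases L with
  | nil => simp [flipRev, dbl]
  | cons a T =>
    have : FreeGroup.invRev (dbl (a :: T)) =
        FreeGroup.invRev T ++ [(a.1, !a.2), (a.1, !a.2)] := by
      simp [dbl, FreeGroup.invRev]
    rw [this]
    exact List.isRotated_append (l := [_, _])

/-- The element represented by `L` squares to one, and free groups are torsion-free. -/
theorem eq_nil_of_eq_invRev {L : List (Letter d)} (hL : FreeGroup.IsReduced L)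
    (h : L = FreeGroup.invRev L) : L = [] := by
  have h1 : (FreeGroup.mk L)⁻¹ = FreeGroup.mk L := by rw [FreeGroup.inv_mk, ← h]
  have h2 : FreeGroup.mk L ^ 2 = 1 := by
    rw [pow_two]; nth_rewrite 1 [← h1]; exact inv_mul_cancel _
  have h3 : FreeGroup.mk L = 1 := by
    rwa [pow_eq_one_iff_left (by norm_num)] at h2
  have h4 := congrArg FreeGroup.toWord h3
  rwa [FreeGroup.toWord_mk, FreeGroup.toWord_one, hL.reduce_eq] at h4

/-- A nonempty reduced word is not a rotation of its inverse. -/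
theorem not_rotated_invRev {L : List (Letter d)} (h0 : L ≠ []) (hL : FreeGroup.IsReduced L) :
    ¬ L ~r FreeGroup.invRev L := by
  intro h
  obtain ⟨n, hn, h⟩ := List.isRotated_iff_mod.1 h
  rw [List.rotate_eq_drop_append_take hn] at h
  have h1 : FreeGroup.invRev L =
      FreeGroup.invRev (L.drop n) ++ FreeGroup.invRev (L.take n) := by
    rw [← FreeGroup.invRev_append, List.take_append_drop]
  -- A rotation `BA` of `AB` equal to `B⁻¹A⁻¹` forces `B = B⁻¹` and `A = A⁻¹`, by comparing lengths.
  rw [h1] at h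
  obtain ⟨h2, h3⟩ := List.append_inj h (by simp)
  have h4 := eq_nil_of_eq_invRev (hL.infix (List.drop_suffix n L).isInfix) h2
  have h5 := eq_nil_of_eq_invRev (hL.infix (List.take_prefix n L).isInfix) h3
  apply h0
  rw [← List.take_append_drop n L, h4, h5]; rfl

theorem rotated_invRev_comm {L M : List (Letter d)} :
    L ~r FreeGroup.invRev M ↔ FreeGroup.invRev L ~r M := by
  constructor <;> intro h <;> simpa using invRev_isRotated h

/-- Both sets split according to whether the classes match by rotation alone or through an
inversion. The map `dbl` matches the first parts and `dbl ∘ flipRev` the second. The parts are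
disjoint on either side by `not_rotated_invRev`, applied to `R` on the left and to `L` on the right.
-/
theorem ncard_doubling_eq {L R : List (Letter d)} (hL0 : L ≠ []) (hL : FreeGroup.IsReduced L)
    (hR0 : R ≠ []) (hR : FreeGroup.IsReduced R) :
    Set.ncard {L' | L' ~r L ∧ ∃ M, L' = dbl M ∧ DihedralEquiv M R} =
      Set.ncard {R' | R' ~r R ∧ DihedralEquiv (dbl R') L} := by
  have finrot : ∀ K : List (Letter d), {M | M ~r K}.Finite := by
    intro K
    refine (List.finite_toSet (K.cyclicPermutations)).subset ?_
    intro M hM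
    exact List.mem_cyclicPermutations_iff.2 hM
  have e1 : {L' | L' ~r L ∧ ∃ M, L' = dbl M ∧ DihedralEquiv M R} =
      dbl '' {R' | R' ~r R ∧ dbl R' ~r L} ∪
        (dbl ∘ flipRev) '' {R' | R' ~r R ∧ dbl R' ~r FreeGroup.invRev L} := by
    ext L'
    simp only [Set.mem_ofPred_eq, Set.mem_union, Set.mem_image, Function.comp]
    constructor
    · rintro ⟨h, M, rfl, h' | h'⟩
      · exact Or.inl ⟨M, ⟨h', h⟩, rfl⟩
      · refine Or.inr ⟨flipRev M, ⟨?_, ?_⟩, by rw [flipRev_flipRev]⟩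
        · exact (flipRev_rotated M).trans (rotated_invRev_comm.1 h')
        · exact (dbl_flipRev_rotated M).trans (invRev_isRotated h)
    · rintro (⟨M, ⟨h', h⟩, rfl⟩ | ⟨M, ⟨h', h⟩, rfl⟩)
      · exact ⟨h, M, rfl, Or.inl h'⟩
      · refine ⟨(dbl_flipRev_rotated M).trans (rotated_invRev_comm.1 h), _, rfl, Or.inr ?_⟩
        exact (flipRev_rotated M).trans (invRev_isRotated h')
  have e2 : {R' | R' ~r R ∧ DihedralEquiv (dbl R') L} =
      {R' | R' ~r R ∧ dbl R' ~r L} ∪ {R' | R' ~r R ∧ dbl R' ~r FreeGroup.invRev L} := by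
    ext R'; simp only [DihedralEquiv, Set.mem_ofPred_eq, Set.mem_union]; tauto
  have fin1 : {R' | R' ~r R ∧ dbl R' ~r L}.Finite := (finrot R).subset fun _ h => h.1
  have fin2 : {R' | R' ~r R ∧ dbl R' ~r FreeGroup.invRev L}.Finite :=
    (finrot R).subset fun _ h => h.1
  rw [e1, e2, Set.ncard_union_eq _ (fin1.image _) (fin2.image _),
    Set.ncard_union_eq _ fin1 fin2, Set.ncard_image_of_injective _ dbl_injective,
    Set.ncard_image_of_injective]
  · exact dbl_injective.comp (Function.LeftInverse.injective flipRev_flipRev)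
  · rw [Set.disjoint_left]
    rintro M ⟨-, h⟩ ⟨-, h'⟩
    exact not_rotated_invRev hL0 hL (h.symm.trans h')
  · rw [Set.disjoint_left]
    rintro _ ⟨M, ⟨h, -⟩, rfl⟩ ⟨M', ⟨h', -⟩, h2⟩
    have h3 := dbl_injective h2
    subst h3
    have h4 := (flipRev_rotated M').symm.trans h
    exact not_rotated_invRev hR0 hR (h4.symm.trans (invRev_isRotated h'))

end Letters

end CycleField

namespace CycleField

/-! ### Counting adjacent letters of the same sign -/

section SameSign

variable {d : ℕ}

/-- The number of cyclically adjacent pairs of letters of the same sign. -/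
def sameSign (L : List (Letter d)) : ℕ :=
  (List.zipWith (fun x y : Letter d => decide (x.2 = y.2)) L (L.rotate 1)).count true

theorem sameSign_rotate (L : List (Letter d)) (n : ℕ) : sameSign (L.rotate n) = sameSign L := by
  unfold sameSign
  rw [List.rotate_rotate, Nat.add_comm n 1, ← List.rotate_rotate,
    ← List.zipWith_rotate_distrib _ _ _ _ (by simp)]
  exact (List.rotate_perm _ _).count_eq _

theorem sameSign_eq_of_rotated {L M : List (Letter d)} (h : L ~r M) :
    sameSign L = sameSign M := by
  obtain ⟨n, rfl⟩ := h
  rw [sameSign_rotate]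

theorem sameSign_reverse (L : List (Letter d)) : sameSign L.reverse = sameSign L := by
  cases L with
  | nil => rfl
  | cons a T =>
    -- With `a` back in front, reversing the list of comparisons for `a :: T` merely exchanges the
    -- two arguments of each comparison.
    have h2 : sameSign (a :: T.reverse) = sameSign (a :: T).reverse :=
      sameSign_eq_of_rotated (by rw [List.reverse_cons]; exact (List.isRotated_concat _ _).symm)
    rw [← h2]
    unfold sameSign
    rw [← List.count_reverse, List.reverse_zipWith (by simp), List.zipWith_comm]
    simp [eq_comm]

theorem sameSign_invRev (L : List (Letter d)) :
    sameSign (FreeGroup.invRev L) = sameSign L := by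
  rw [FreeGroup.invRev, sameSign_reverse]
  unfold sameSign
  rw [← List.map_rotate, List.zipWith_map]
  simp

theorem sameSign_eq_of_dihedralEquiv {L M : List (Letter d)} (h : DihedralEquiv L M) :
    sameSign L = sameSign M := by
  rcases h with h | h
  · exact sameSign_eq_of_rotated h
  · rw [sameSign_eq_of_rotated h, sameSign_invRev]

theorem sameSign_dbl {L : List (Letter d)} (h : L ≠ []) :
    sameSign (dbl L) = sameSign L + 1 := by
  cases L with
  | nil => exact absurd rfl h
  | cons a T => simp [sameSign, dbl]

theorem sameSign_le (L : List (Letter d)) : sameSign L ≤ L.length := by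
  refine List.count_le_length.trans ?_
  simp

end SameSign

/-! ### Cyclic reduction as a property of cycles -/

section CyclicReduction

variable {d : ℕ}

theorem isCyclicallyReduced_cons_iff {a : Letter d} {T : List (Letter d)} :
    FreeGroup.IsCyclicallyReduced (a :: T) ↔
      List.IsChain (fun a b : Letter d => a.1 = b.1 → a.2 = b.2) (a :: (T ++ [a])) := by
  rw [← List.cons_append, List.isChain_append, FreeGroup.isCyclicallyReduced_iff]
  simp [FreeGroup.IsReduced]

/-- A formulation on `Cycle`, from which invariance under rotation is immediate. -/
theorem isCyclicallyReduced_iff_chain {L : List (Letter d)} :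
    FreeGroup.IsCyclicallyReduced L ↔
      Cycle.Chain (fun a b : Letter d => a.1 = b.1 → a.2 = b.2) (L : Cycle (Letter d)) := by
  cases L with
  | nil => simp
  | cons a T => rw [isCyclicallyReduced_cons_iff, Cycle.chain_coe_cons]

theorem isCyclicallyReduced_of_rotated {L M : List (Letter d)} (h : L ~r M) :
    FreeGroup.IsCyclicallyReduced L ↔ FreeGroup.IsCyclicallyReduced M := by
  rw [isCyclicallyReduced_iff_chain, isCyclicallyReduced_iff_chain, Cycle.coe_eq_coe.2 h]

theorem isCyclicallyReduced_dbl {L : List (Letter d)} :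
    FreeGroup.IsCyclicallyReduced (dbl L) ↔ FreeGroup.IsCyclicallyReduced L := by
  cases L with
  | nil => rfl
  | cons a T =>
    rw [dbl, isCyclicallyReduced_cons_iff, isCyclicallyReduced_cons_iff, List.cons_append,
      List.isChain_cons_cons]
    simp

end CyclicReduction

/-! ### Replacing positions by rotations -/

section ListPositions

variable {α : Type*} {d : ℕ}

theorem double_pair_iff {L : List α} {i : ℕ} (hi : i < L.length) :
    (2 ≤ L.length ∧ L[i]? = L[(i + 1) % L.length]?) ↔ ∃ a T, L.rotate i = a :: a :: T := by
  have h0 : (L.rotate i)[0]? = L[i]? := by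
    rw [List.getElem?_rotate (by omega), Nat.zero_add, Nat.mod_eq_of_lt hi]
  have hlen : (L.rotate i).length = L.length := List.length_rotate _ _
  constructor
  · rintro ⟨h2, h⟩
    have h1 : (L.rotate i)[1]? = L[(i + 1) % L.length]? := by
      rw [List.getElem?_rotate (by omega), Nat.add_comm]
    rw [← h1, ← h0] at h
    rcases hL : L.rotate i with _ | ⟨a, _ | ⟨b, T⟩⟩
    · simp [hL] at hlen; omega
    · simp [hL] at hlen; omega
    · simp [hL] at h
      exact ⟨a, T, by rw [h]⟩
  · rintro ⟨a, T, h⟩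
    rw [h] at hlen h0
    have h2 : 2 ≤ L.length := by rw [← hlen]; simp
    have h1 : (L.rotate i)[1]? = L[(i + 1) % L.length]? := by
      rw [List.getElem?_rotate (by omega), Nat.add_comm]
    refine ⟨h2, ?_⟩
    rw [← h0, ← h1, h]; rfl

theorem eraseIdx_rotated {L : List α} {i : ℕ} (hi : i < L.length) :
    L.eraseIdx i ~r (L.rotate i).tail := by
  rw [List.rotate_eq_drop_append_take hi.le, List.drop_eq_getElem_cons hi,
    List.eraseIdx_eq_take_drop_succ]
  exact List.isRotated_append

theorem take_append_drop_rotated {L : List (Letter d)} {i : ℕ} (hi : i < L.length) :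
    L.take (i + 1) ++ L.drop i ~r dbl (L.rotate i) := by
  rw [List.rotate_eq_drop_append_take hi.le, List.drop_eq_getElem_cons hi,
    List.take_succ_eq_append_getElem hi]
  simp only [List.cons_append, dbl, List.append_assoc, List.nil_append]
  exact List.isRotated_append (l' := _ :: _ :: _)

end ListPositions

theorem dihedralEquiv_congr_left {d : ℕ} {L L' M : List (Letter d)} (h : L ~r L') :
    DihedralEquiv L M ↔ DihedralEquiv L' M :=
  ⟨fun h' => (dihedralEquiv_equivalence d).trans (Or.inl h.symm) h',
    fun h' => (dihedralEquiv_equivalence d).trans (Or.inl h) h'⟩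

theorem DihedralEquiv.length_eq {d : ℕ} {L M : List (Letter d)} (h : DihedralEquiv L M) :
    L.length = M.length := by
  rcases h with h | h
  · exact h.perm.length_eq
  · rw [h.perm.length_eq, FreeGroup.invRev_length]

/-! ### Counts and statistics of word classes -/

namespace WordClass

variable {d : ℕ}

theorem rep_ne_nil (w : WordClass d) : w.rep ≠ [] := (Quotient.out w).2.1

theorem len_pos (w : WordClass d) : 0 < w.len := List.length_pos_iff.2 w.rep_ne_nil

theorem isCyclicallyReduced_rep (w : WordClass d) : FreeGroup.IsCyclicallyReduced w.rep :=
  (Quotient.out w).2.2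

theorem ext_rep {u w : WordClass d} (h : DihedralEquiv u.rep w.rep) : u = w := by
  rw [← Quotient.out_eq u, ← Quotient.out_eq w]
  exact Quotient.sound h

theorem existsUnique_dihedralEquiv {L : List (Letter d)} (h0 : L ≠ [])
    (hL : FreeGroup.IsCyclicallyReduced L) : ∃! w : WordClass d, DihedralEquiv L w.rep := by
  have h1 : DihedralEquiv (rep (Quotient.mk (wordSetoid d) ⟨L, h0, hL⟩ : WordClass d)) L :=
    Quotient.mk_out (s := wordSetoid d) ⟨L, h0, hL⟩
  refine ⟨_, (dihedralEquiv_equivalence d).symm h1, fun w hw => ext_rep ?_⟩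
  exact (dihedralEquiv_equivalence d).symm ((dihedralEquiv_equivalence d).trans h1 hw)

instance : Countable (WordClass d) := by
  have : Countable (Word d) := Subtype.countable
  exact inferInstanceAs (Countable (Quotient (wordSetoid d)))

instance : MeasurableSingletonClass (WordClass d) := ⟨fun _ => trivial⟩

theorem isDoublePair_iff (w : WordClass d) {i : ℕ} (hi : i < w.len) :
    w.IsDoublePair i ↔ ∃ a T, w.rep.rotate i = a :: a :: T :=
  double_pair_iff hi

open Classical in
-- Halving at position `i` means that the rotation by `i` has the form `dbl M` and that `M`
-- represents `u`; `card_filter_rotate` then extracts the factor `h`.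
theorem halvingCount_eq (w u : WordClass d) : w.halvingCount u =
    w.h * Set.ncard {L | L ~r w.rep ∧ ∃ M, L = dbl M ∧ DihedralEquiv M u.rep} := by
  rw [h, ← card_filter_rotate _ w.rep_ne_nil, halvingCount]
  congr 1
  refine Finset.filter_congr fun i hi => ?_
  have hi' : i < w.len := Finset.mem_range.1 hi
  rw [isDoublePair_iff w hi', dihedralEquiv_congr_left (eraseIdx_rotated hi')]
  constructor
  · rintro ⟨⟨a, T, h⟩, h'⟩
    refine ⟨a :: T, h, ?_⟩
    rwa [h] at h'
  · rintro ⟨M, h, h'⟩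
    rcases M with _ | ⟨a, T⟩
    · exact absurd (List.length_eq_zero_iff.1 h'.length_eq.symm) u.rep_ne_nil
    · exact ⟨⟨a, T, h⟩, by rwa [h]⟩

open Classical in
theorem doublingCount_eq (u w : WordClass d) : u.doublingCount w =
    u.h * Set.ncard {R | R ~r u.rep ∧ DihedralEquiv (dbl R) w.rep} := by
  rw [h, ← card_filter_rotate _ u.rep_ne_nil, doublingCount]
  congr 1
  refine Finset.filter_congr fun i hi => ?_
  exact dihedralEquiv_congr_left (take_append_drop_rotated (Finset.mem_range.1 hi))

theorem h_pos (w : WordClass d) : 0 < w.h := by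
  have := sSup_exponent w.rep w.rep_ne_nil
  refine Nat.pos_of_ne_zero fun h0 => ?_
  rw [h] at h0
  rw [h0, Nat.zero_mul] at this
  exact w.len_pos.ne this

/-- Detailed balance of the halving and doubling rates. -/
theorem h_mul_halvingCount (w u : WordClass d) :
    u.h * w.halvingCount u = w.h * u.doublingCount w := by
  rw [halvingCount_eq, doublingCount_eq, ncard_doubling_eq w.rep_ne_nil
    w.isCyclicallyReduced_rep.isReduced u.rep_ne_nil u.isCyclicallyReduced_rep.isReduced]
  ring

theorem b_eq (w : WordClass d) : w.b = sameSign w.rep := by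
  rw [b, sameSign, ← Nat.count_eq_card_filter_range, Nat.count, List.count,
    List.countP_eq_length_filter, List.countP_eq_length_filter]
  have : List.zipWith (fun x y : Letter d => decide (x.2 = y.2)) w.rep (w.rep.rotate 1) =
      (List.range w.len).map fun i => decide
        (w.rep[i]?.map Prod.snd = w.rep[(i + 1) % w.len]?.map Prod.snd) := by
    refine List.ext_getElem (by simp [len]) fun i h1 h2 => ?_
    have hi : i < w.rep.length := by simpa [len] using h2
    have hi' : (i + 1) % w.rep.length < w.rep.length := Nat.mod_lt _ w.len_pos
    simp [List.getElem_rotate, len, List.getElem?_eq_getElem hi, List.getElem?_eq_getElem hi']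
  rw [this, List.filter_map, List.length_map]
  congr 1
  refine List.filter_congr fun i _ => ?_
  simp

theorem b_le_len (w : WordClass d) : w.b ≤ w.len := by
  rw [b_eq]; exact sameSign_le _

theorem of_doublingCount_ne_zero {u w : WordClass d} (h : u.doublingCount w ≠ 0) :
    w.len = u.len + 1 ∧ w.b = u.b + 1 := by
  classical
  unfold doublingCount at h
  obtain ⟨i, hi⟩ := Finset.card_pos.1 (Nat.pos_of_ne_zero h)
  obtain ⟨hi, h'⟩ := Finset.mem_filter.1 hi
  have h1 := take_append_drop_rotated (Finset.mem_range.1 hi)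
  rw [dihedralEquiv_congr_left h1] at h'
  have hne : u.rep.rotate i ≠ [] := by simpa using u.rep_ne_nil
  constructor
  · rw [len, ← h'.length_eq]
    have := List.length_rotate u.rep i
    rcases hu : u.rep.rotate i with _ | ⟨a, T⟩
    · exact absurd hu hne
    · rw [hu] at this
      simp only [dbl, List.length_cons, len] at this ⊢
      omega
  · rw [b_eq, b_eq, ← sameSign_eq_of_dihedralEquiv h', sameSign_dbl hne, sameSign_rotate]

theorem of_halvingCount_ne_zero {w u : WordClass d} (h : w.halvingCount u ≠ 0) :
    w.len = u.len + 1 := by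
  refine (of_doublingCount_ne_zero (u := u) (w := w) fun h0 => h ?_).1
  have := h_mul_halvingCount w u
  rw [h0, Nat.mul_zero] at this
  exact (Nat.mul_eq_zero.1 this).resolve_left u.h_pos.ne'

end WordClass

open Classical in
-- Each index is counted for exactly one `y`. This turns sums of rates over target classes into
-- numbers of letters or pairs.
theorem tsum_card_filter {ι β : Type*} (s : Finset ι) (p : ι → β → Prop)
    (h : ∀ i ∈ s, ∃! y, p i y) :
    ∑' y, (((s.filter fun i => p i y).card : ℕ) : ℝ≥0∞) = s.card := by
  have h1 : ∀ y, (((s.filter fun i => p i y).card : ℕ) : ℝ≥0∞) =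
      ∑ i ∈ s, if p i y then 1 else 0 := by
    intro y; simp
  simp_rw [h1]
  rw [Summable.tsum_finsetSum fun _ _ => ENNReal.summable]
  rw [Finset.card_eq_sum_ones, Nat.cast_sum]
  refine Finset.sum_congr rfl fun i hi => ?_
  obtain ⟨y, hy, huniq⟩ := h i hi
  rw [tsum_eq_single y fun z hz => if_neg fun hp => hz (huniq z hp), if_pos hy]
  simp

variable {d : ℕ}

theorem exitRate_doublingRate (u : WordClass d) : exitRate doublingRate u = u.len := by
  classical
  unfold exitRate doublingRate WordClass.doublingCount
  rw [tsum_card_filter _ (fun i (w : WordClass d) =>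
    DihedralEquiv (u.rep.take (i + 1) ++ u.rep.drop i) w.rep), Finset.card_range]
  intro i hi
  have h1 := take_append_drop_rotated (Finset.mem_range.1 hi)
  apply WordClass.existsUnique_dihedralEquiv
  · simp [u.rep_ne_nil]
  · rw [isCyclicallyReduced_of_rotated h1, isCyclicallyReduced_dbl,
      isCyclicallyReduced_of_rotated (List.IsRotated.forall _ _)]
    exact u.isCyclicallyReduced_rep

theorem tsum_halvingCount (w : WordClass d) : ∑' u, (w.halvingCount u : ℝ≥0∞) = w.c := by
  classical
  unfold WordClass.halvingCount WordClass.c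
  simp_rw [← Finset.filter_filter]
  rw [tsum_card_filter _ (fun i (u : WordClass d) => DihedralEquiv (w.rep.eraseIdx i) u.rep)]
  intro i hi
  obtain ⟨hi, hp⟩ := Finset.mem_filter.1 hi
  have hi := Finset.mem_range.1 hi
  have h1 := eraseIdx_rotated hi
  obtain ⟨a, T, hT⟩ := (w.isDoublePair_iff hi).1 hp
  rw [hT] at h1
  apply WordClass.existsUnique_dihedralEquiv
  · intro h0
    rw [h0, List.isRotated_nil_iff'] at h1
    simp at h1
  · rw [isCyclicallyReduced_of_rotated h1]
    have h2 := w.isCyclicallyReduced_rep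
    rw [← isCyclicallyReduced_of_rotated (List.IsRotated.forall _ i), hT] at h2
    exact (isCyclicallyReduced_dbl (L := a :: T)).1 h2

theorem tsum_option_eq {β : Type*} (f : Option β → ℝ≥0∞) :
    ∑' y, f y = f none + ∑' y, f (some y) := by
  rw [← (Equiv.optionEquivSumPUnit.{0} β).symm.tsum_eq f, ENNReal.summable.tsum_sum ENNReal.summable,
    add_comm]
  simp

/-- The `c(w)` halvings and the killing rate add up to `|w|`; the subtraction in the rate is not
truncated because `c(w) ≤ |w|`. -/
theorem exitRate_halvingRate (w : WordClass d) : exitRate halvingRate (some w) = w.len := by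
  classical
  rw [exitRate, tsum_option_eq]
  simp only [halvingRate]
  rw [tsum_halvingCount, ← Nat.cast_add]
  have : w.c ≤ w.len := by
    rw [WordClass.c]
    exact (Finset.card_filter_le _ _).trans (by simp)
  rw [Nat.sub_add_cancel this]

end CycleField

namespace CycleField

/-! ### Transition functions of the halving and doubling chains -/

section PathWeight

variable {S : Type*}

open Classical in
/-- The sum over all paths of `n` jumps from `x` to `y` of the products of the jump rates. -/
noncomputable def pathWeight (q : S → S → ℝ≥0∞) : ℕ → S → S → ℝ≥0∞
  | 0, x, y => if x = y then 1 else 0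
  | n + 1, x, y => ∑' z, q x z * pathWeight q n z y

theorem pathWeight_succ (q : S → S → ℝ≥0∞) (n : ℕ) (x y : S) :
    pathWeight q (n + 1) x y = ∑' z, q x z * pathWeight q n z y := rfl

/-- Decomposition at the last jump instead of the first, needed since reversal turns a first halving
into a last doubling. -/
theorem pathWeight_succ' (q : S → S → ℝ≥0∞) (n : ℕ) : ∀ (x y : S),
    pathWeight q (n + 1) x y = ∑' z, pathWeight q n x z * q z y := by
  classical
  induction n with
  | zero =>
    intro x y
    rw [pathWeight, tsum_eq_single y, tsum_eq_single x]
    · simp [pathWeight]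
    · intro z hz; simp [pathWeight, hz.symm]
    · intro z hz; simp [pathWeight, hz]
  | succ n ih =>
    intro x y
    rw [pathWeight_succ]
    simp_rw [ih]
    rw [show (∑' z, q x z * ∑' z', pathWeight q n z z' * q z' y) =
      ∑' z, ∑' z', q x z * (pathWeight q n z z' * q z' y) from
        tsum_congr fun _ => ENNReal.tsum_mul_left.symm, ENNReal.tsum_comm]
    refine tsum_congr fun z' => ?_
    rw [← ih, pathWeight_succ, ← ENNReal.tsum_mul_right]
    exact tsum_congr fun _ => (mul_assoc _ _ _).symm

end PathWeight

/-! ### The time factor of the jump probabilities -/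

theorem lintegral_Icc_of_hasDerivAt {s : ℝ} (hs : 0 ≤ s) {f F : ℝ → ℝ}
    (hF : ∀ r, HasDerivAt F (f r) r) (hf : Continuous f) (h0 : ∀ r ∈ Set.Icc 0 s, 0 ≤ f r) :
    ∫⁻ r in Set.Icc 0 s, ENNReal.ofReal (f r) = ENNReal.ofReal (F s - F 0) := by
  rw [← intervalIntegral.integral_eq_sub_of_hasDerivAt (fun r _ => hF r)
    (hf.intervalIntegrable 0 s), intervalIntegral.integral_of_le hs,
    ← integral_Icc_eq_integral_Ioc, ofReal_integral_eq_lintegral_ofReal]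
  · exact hf.continuousOn.integrableOn_Icc
  · filter_upwards [ae_restrict_mem measurableSet_Icc] with r hr using h0 r hr

/-- The time dependence of the probability of `n` jumps, when the exit rates are
`k, k + 1, …, k + n` in increasing or decreasing order. -/
noncomputable def jumpWeight (n k : ℕ) (s : ℝ) : ℝ≥0∞ :=
  ENNReal.ofReal (Real.exp (-k * s) * (1 - Real.exp (-s)) ^ n / n.factorial)

theorem measurable_jumpWeight (n k : ℕ) : Measurable (jumpWeight n k) := by
  unfold jumpWeight; fun_prop

theorem lintegral_jumpWeight_up (n k : ℕ) {s : ℝ} (hs : 0 ≤ s) :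
    ∫⁻ r in Set.Icc 0 s, ENNReal.ofReal (Real.exp (-k * r)) * jumpWeight n (k + 1) (s - r) =
      jumpWeight (n + 1) k s := by
  set f : ℝ → ℝ := fun r => Real.exp (-k * s) *
    (Real.exp (-(s - r)) * (1 - Real.exp (-(s - r))) ^ n) / n.factorial with hf
  -- The exponentials combine to `e^{-ks} e^{-(s-r)}`, and the last factor is, up to sign, the
  -- derivative of `1 - e^{-(s-r)}`.
  set F : ℝ → ℝ := fun r =>
    -(Real.exp (-k * s) * (1 - Real.exp (-(s - r))) ^ (n + 1) / (n + 1).factorial) with hF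
  have h1 : ∫⁻ r in Set.Icc 0 s, ENNReal.ofReal (Real.exp (-k * r)) *
      jumpWeight n (k + 1) (s - r) = ∫⁻ r in Set.Icc 0 s, ENNReal.ofReal (f r) := by
    refine lintegral_congr fun r => ?_
    rw [jumpWeight, ← ENNReal.ofReal_mul (Real.exp_pos _).le]
    congr 1
    have : Real.exp (-k * s) * Real.exp (-(s - r)) =
        Real.exp (-k * r) * Real.exp (-((k + 1 : ℕ) : ℝ) * (s - r)) := by
      rw [← Real.exp_add, ← Real.exp_add]; congr 1; push_cast; ring
    rw [hf]
    linear_combination (-(1 - Real.exp (-(s - r))) ^ n / n.factorial) * this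
  have hd : ∀ r, HasDerivAt F (f r) r := by
    intro r
    have e1 : HasDerivAt (fun r : ℝ => -(s - r)) 1 r := by
      simpa [Pi.neg_def] using ((hasDerivAt_id' r).sub_const s)
    have e2 := (((e1.exp.const_sub 1).pow (n + 1)).const_mul (Real.exp (-k * s))).div_const
      ((n + 1).factorial : ℝ)
    refine e2.neg.congr_deriv ?_
    have h0 : (n.factorial : ℝ) ≠ 0 := by positivity
    rw [hf, Nat.factorial_succ]
    push_cast
    field_simp
  rw [h1, lintegral_Icc_of_hasDerivAt hs hd (by fun_prop), jumpWeight]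
  · congr 1
    simp [hF]
  · intro r hr
    have : Real.exp (-(s - r)) ≤ 1 := Real.exp_le_one_iff.2 (by linarith [hr.2])
    have : 0 ≤ 1 - Real.exp (-(s - r)) := by linarith
    positivity

theorem lintegral_jumpWeight_down (n k : ℕ) {s : ℝ} (hs : 0 ≤ s) :
    ∫⁻ r in Set.Icc 0 s, ENNReal.ofReal (Real.exp (-(n + 1 + k : ℕ) * r)) *
      jumpWeight n k (s - r) = jumpWeight (n + 1) k s := by
  set f : ℝ → ℝ := fun r => Real.exp (-k * s) *
    (Real.exp (-r) * (Real.exp (-r) - Real.exp (-s)) ^ n) / n.factorial with hf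
  -- Here `e^{-nr}` is absorbed into the `n`th power, turning `1 - e^{-(s-r)}` into `e^{-r} -
  -- e^{-s}`.
  set F : ℝ → ℝ := fun r =>
    -(Real.exp (-k * s) * (Real.exp (-r) - Real.exp (-s)) ^ (n + 1) / (n + 1).factorial) with hF
  have h1 : ∫⁻ r in Set.Icc 0 s, ENNReal.ofReal (Real.exp (-(n + 1 + k : ℕ) * r)) *
      jumpWeight n k (s - r) = ∫⁻ r in Set.Icc 0 s, ENNReal.ofReal (f r) := by
    refine lintegral_congr fun r => ?_
    rw [jumpWeight, ← ENNReal.ofReal_mul (Real.exp_pos _).le]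
    congr 1
    have e1 : Real.exp (-(n + 1 + k : ℕ) * r) * Real.exp (-k * (s - r)) =
        Real.exp (-k * s) * Real.exp (-r) * Real.exp (-r) ^ n := by
      rw [← Real.exp_nat_mul, ← Real.exp_add, ← Real.exp_add, ← Real.exp_add]
      congr 1; push_cast; ring
    have e2 : Real.exp (-r) - Real.exp (-s) = Real.exp (-r) * (1 - Real.exp (-(s - r))) := by
      rw [mul_sub, ← Real.exp_add]; ring_nf
    rw [hf]
    simp only
    rw [e2, mul_pow]
    linear_combination ((1 - Real.exp (-(s - r))) ^ n / n.factorial) * e1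
  have hd : ∀ r, HasDerivAt F (f r) r := by
    intro r
    have e2 := ((((hasDerivAt_neg r).exp.sub_const (Real.exp (-s))).pow (n + 1)).const_mul
      (Real.exp (-k * s))).div_const ((n + 1).factorial : ℝ)
    refine e2.neg.congr_deriv ?_
    have h0 : (n.factorial : ℝ) ≠ 0 := by positivity
    rw [hf, Nat.factorial_succ]
    push_cast
    field_simp
  rw [h1, lintegral_Icc_of_hasDerivAt hs hd (by fun_prop), jumpWeight]
  · congr 1
    simp [hF]
  · intro r hr
    have : Real.exp (-s) ≤ Real.exp (-r) := Real.exp_le_exp.2 (by linarith [hr.2])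
    have : 0 ≤ Real.exp (-r) - Real.exp (-s) := by linarith
    positivity

variable {d : ℕ}

theorem of_doublingRate_ne_zero {u w : WordClass d} (h : doublingRate u w ≠ 0) :
    w.len = u.len + 1 ∧ w.b = u.b + 1 :=
  WordClass.of_doublingCount_ne_zero fun h0 => h (by simp [doublingRate, h0])

/-- Along every path the exit rates are `|u|, |u| + 1, …, |u| + n`, so the law of the holding times
does not depend on the path. -/
theorem jumpProb_doubling (n : ℕ) : ∀ {s : ℝ}, 0 ≤ s → ∀ u w : WordClass d,
    jumpProb doublingRate n s u w = pathWeight doublingRate n u w * jumpWeight n u.len s := by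
  classical
  induction n with
  | zero =>
    intro s hs u w
    rw [jumpProb, pathWeight, exitRate_doublingRate]
    simp [jumpWeight]
  | succ n ih =>
    intro s hs u w
    rw [jumpProb, exitRate_doublingRate, ← lintegral_jumpWeight_up n u.len hs,
      ← lintegral_const_mul _ (by
        have := measurable_jumpWeight n (u.len + 1)
        fun_prop)]
    refine setLIntegral_congr_fun measurableSet_Icc fun r hr => ?_
    have h1 : ∀ z, doublingRate u z * jumpProb doublingRate n (s - r) z w =
        doublingRate u z * pathWeight doublingRate n z w * jumpWeight n (u.len + 1) (s - r) := by
      intro z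
      by_cases hz : doublingRate u z = 0
      · simp [hz]
      · rw [ih (by linarith [hr.2]), (of_doublingRate_ne_zero hz).1, mul_assoc]
    simp only [h1, ENNReal.tsum_mul_right]
    rw [pathWeight_succ, ENNReal.toReal_natCast]
    ring

theorem jumpProb_halving_none (n : ℕ) (s : ℝ) (u : WordClass d) :
    jumpProb halvingRate n s none (some u) = 0 := by
  cases n <;> simp [jumpProb, halvingRate]

theorem pathWeight_halving_none (n : ℕ) (u : WordClass d) :
    pathWeight halvingRate n none (some u) = 0 := by
  cases n <;> simp [pathWeight, halvingRate]

theorem pathWeight_halving_succ (n : ℕ) (w u : WordClass d) :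
    pathWeight halvingRate (n + 1) (some w) (some u) =
      ∑' z, (w.halvingCount z : ℝ≥0∞) * pathWeight halvingRate n (some z) (some u) := by
  rw [pathWeight_succ, tsum_option_eq, pathWeight_halving_none]
  simp [halvingRate]

theorem of_pathWeight_halving_ne_zero (n : ℕ) : ∀ {w u : WordClass d},
    pathWeight halvingRate n (some w) (some u) ≠ 0 → w.len = n + u.len := by
  induction n with
  | zero =>
    intro w u h
    have : w = u := by
      by_contra hne; simp [pathWeight, hne] at h
    simp [this]
  | succ n ih =>
    intro w u h
    rw [pathWeight_halving_succ] at h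
    obtain ⟨z, hz⟩ : ∃ z, (w.halvingCount z : ℝ≥0∞) *
        pathWeight halvingRate n (some z) (some u) ≠ 0 := by
      by_contra! h0
      exact h (ENNReal.tsum_eq_zero.2 h0)
    rw [mul_ne_zero_iff] at hz
    have h1 := WordClass.of_halvingCount_ne_zero (w := w) (u := z) (by exact_mod_cast hz.1)
    have h2 := ih hz.2
    omega

theorem jumpProb_halving (n : ℕ) : ∀ {s : ℝ}, 0 ≤ s → ∀ w u : WordClass d,
    jumpProb halvingRate n s (some w) (some u) =
      pathWeight halvingRate n (some w) (some u) * jumpWeight n u.len s := by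
  classical
  induction n with
  | zero =>
    intro s hs w u
    rw [jumpProb, pathWeight, exitRate_halvingRate]
    by_cases h : w = u <;> simp [jumpWeight, h]
  | succ n ih =>
    intro s hs w u
    have h1 : ∀ r ∈ Set.Icc 0 s,
        ENNReal.ofReal (Real.exp (-(exitRate halvingRate (some w)).toReal * r)) *
          ∑' z, halvingRate (some w) z * jumpProb halvingRate n (s - r) z (some u) =
        pathWeight halvingRate (n + 1) (some w) (some u) *
          (ENNReal.ofReal (Real.exp (-(w.len : ℝ) * r)) * jumpWeight n u.len (s - r)) := by
      intro r hr
      rw [tsum_option_eq, jumpProb_halving_none, mul_zero, zero_add, exitRate_halvingRate,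
        ENNReal.toReal_natCast, pathWeight_halving_succ]
      simp only [ih (sub_nonneg.2 hr.2), halvingRate, ← mul_assoc]
      rw [ENNReal.tsum_mul_right]
      ring
    rw [jumpProb, setLIntegral_congr_fun measurableSet_Icc h1,
      lintegral_const_mul _ (by
        have := measurable_jumpWeight n u.len
        fun_prop)]
    -- Only when some path exists is `|w|` known to be `n + 1 + |u|`, as the time integral requires.
    by_cases h0 : pathWeight halvingRate (n + 1) (some w) (some u) = 0
    · simp [h0]
    · rw [of_pathWeight_halving_ne_zero _ h0, lintegral_jumpWeight_down n u.len hs]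

/-- Detailed balance is applied jump by jump; the factors `h` of the intermediate words cancel. -/
theorem pathWeight_duality (n : ℕ) : ∀ w u : WordClass d,
    (u.h : ℝ≥0∞) * pathWeight halvingRate n (some w) (some u) =
      w.h * pathWeight doublingRate n u w := by
  induction n with
  | zero =>
    intro w u
    by_cases h : w = u
    · simp [pathWeight, h]
    · simp [pathWeight, h, Ne.symm h]
  | succ n ih =>
    intro w u
    rw [pathWeight_halving_succ, pathWeight_succ', ← ENNReal.tsum_mul_left,
      ← ENNReal.tsum_mul_left]
    refine tsum_congr fun z => ?_
    have h1 : (z.h : ℝ≥0∞) * w.halvingCount z = w.h * z.doublingCount w := by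
      exact_mod_cast WordClass.h_mul_halvingCount w z
    calc (u.h : ℝ≥0∞) * (w.halvingCount z * pathWeight halvingRate n (some z) (some u))
        = w.halvingCount z * (u.h * pathWeight halvingRate n (some z) (some u)) := by ring
      _ = pathWeight doublingRate n u z * (z.h * w.halvingCount z) := by rw [ih]; ring
      _ = _ := by rw [h1, doublingRate]; ring

/-- Up to the factors `h`, the halving chain is the time reversal of the doubling chain. -/
theorem transProb_duality {s : ℝ} (hs : 0 ≤ s) (w u : WordClass d) :
    (u.h : ℝ≥0∞) * transProb halvingRate s (some w) (some u) =
      w.h * transProb doublingRate s u w := by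
  rw [transProb, transProb, ← ENNReal.tsum_mul_left, ← ENNReal.tsum_mul_left]
  refine tsum_congr fun n => ?_
  rw [jumpProb_halving n hs, jumpProb_doubling n hs, ← mul_assoc, pathWeight_duality, mul_assoc]

theorem of_pathWeight_doubling_ne_zero (n : ℕ) : ∀ {u w : WordClass d},
    pathWeight doublingRate n u w ≠ 0 → w.len = u.len + n ∧ w.b = u.b + n := by
  induction n with
  | zero =>
    intro u w h
    have : u = w := by
      by_contra hne; simp [pathWeight, hne] at h
    simp [this]
  | succ n ih =>
    intro u w h
    rw [pathWeight_succ] at h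
    obtain ⟨z, hz⟩ : ∃ z, doublingRate u z * pathWeight doublingRate n z w ≠ 0 := by
      by_contra! h0
      exact h (ENNReal.tsum_eq_zero.2 h0)
    rw [mul_ne_zero_iff] at hz
    have h1 := of_doublingRate_ne_zero hz.1
    have h2 := ih hz.2
    omega

/-- The total rate at length `k` is `k`, which gives the rising factorial `k (k + 1) ⋯ (k + n - 1)`.
-/
theorem tsum_pathWeight_doubling (n : ℕ) : ∀ u : WordClass d,
    ∑' w, pathWeight doublingRate n u w = (u.len.ascFactorial n : ℕ) := by
  classical
  induction n with
  | zero =>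
    intro u
    simp [pathWeight]
  | succ n ih =>
    intro u
    simp only [pathWeight_succ]
    rw [ENNReal.tsum_comm]
    have h1 : ∀ z, ∑' w, doublingRate u z * pathWeight doublingRate n z w =
        doublingRate u z * ((u.len + 1).ascFactorial n : ℕ) := by
      intro z
      rw [ENNReal.tsum_mul_left, ih]
      by_cases hz : doublingRate u z = 0
      · simp [hz]
      · rw [(of_doublingRate_ne_zero hz).1]
    simp only [h1]
    rw [ENNReal.tsum_mul_right]
    have := exitRate_doublingRate u
    rw [exitRate] at this
    rw [this, ← Nat.cast_mul, Nat.succ_ascFactorial, ← Nat.ascFactorial_succ]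

/-- The expected length of the doubling chain grows exponentially. -/
theorem tsum_transProb_doubling_mul_len {s : ℝ} (hs : 0 ≤ s) (u : WordClass d) :
    ∑' w, transProb doublingRate s u w * w.len = ENNReal.ofReal (u.len * Real.exp s) := by
  have h1 : ∀ w : WordClass d, transProb doublingRate s u w * w.len =
      ∑' n, jumpWeight n u.len s * ((u.len + n : ℕ) * pathWeight doublingRate n u w) := by
    intro w
    rw [transProb, ← ENNReal.tsum_mul_right]
    refine tsum_congr fun n => ?_
    rw [jumpProb_doubling n hs]
    by_cases h0 : pathWeight doublingRate n u w = 0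
    · simp [h0]
    · rw [(of_pathWeight_doubling_ne_zero n h0).1]; ring
  simp only [h1]
  rw [ENNReal.tsum_comm]
  simp only [ENNReal.tsum_mul_left, tsum_pathWeight_doubling]
  set k := u.len
  have hx0 : 0 < Real.exp (-s) := Real.exp_pos _
  have hx1 : Real.exp (-s) ≤ 1 := Real.exp_le_one_iff.2 (by linarith)
  have hx : 0 ≤ 1 - Real.exp (-s) := by linarith
  -- The extra factor `k + n` raises the rising factorial to `k ⋯ (k + n)`, so that the series
  -- becomes a negative binomial one. With `x = e^{-s}` its sum is `x^{-(k+1)}`, and the prefactor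
  -- `k x^k` leaves `k e^s`.
  have h2 : ∀ n : ℕ, jumpWeight n k s * ((k + n : ℕ) * (k.ascFactorial n : ℕ)) =
      ENNReal.ofReal (k * Real.exp (-k * s) *
        ((n + k).choose k * (1 - Real.exp (-s)) ^ n)) := by
    intro n
    have e1 : (k + n) * k.ascFactorial n = k * (n.factorial * (n + k).choose k) := by
      rw [← Nat.succ_ascFactorial, Nat.ascFactorial_eq_factorial_mul_choose,
        Nat.add_comm n k, Nat.choose_symm_add]
    rw [← Nat.cast_mul, e1, jumpWeight, ← ENNReal.ofReal_natCast, ← ENNReal.ofReal_mul (by positivity)]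
    congr 1
    push_cast
    field_simp
  simp only [h2]
  have h3 : HasSum (fun n : ℕ => ((n + k).choose k : ℝ) * (1 - Real.exp (-s)) ^ n)
      (1 / (1 - (1 - Real.exp (-s))) ^ (k + 1)) :=
    hasSum_choose_mul_geometric_of_norm_lt_one k (by
      rw [Real.norm_of_nonneg hx]; linarith)
  have h4 := h3.mul_left (k * Real.exp (-k * s))
  rw [← ENNReal.ofReal_tsum_of_nonneg (fun n => by positivity) h4.summable, h4.tsum_eq]
  congr 1
  have e2 : Real.exp (-k * s) = Real.exp (-s) ^ k := by
    rw [← Real.exp_nat_mul]; ring_nf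
  have e3 : Real.exp s = (Real.exp (-s))⁻¹ := by rw [Real.exp_neg, inv_inv]
  rw [sub_sub_cancel, e2, e3]
  field_simp
  rw [pow_succ]; ring

theorem of_transProb_doubling_ne_zero {s : ℝ} (hs : 0 ≤ s) {u w : WordClass d}
    (h : transProb doublingRate s u w ≠ 0) : w.b + u.len = w.len + u.b := by
  obtain ⟨n, hn⟩ : ∃ n, jumpProb doublingRate n s u w ≠ 0 := by
    by_contra! h0
    exact h (ENNReal.tsum_eq_zero.2 h0)
  rw [jumpProb_doubling n hs, mul_ne_zero_iff] at hn
  have := of_pathWeight_doubling_ne_zero n hn.1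
  omega

end CycleField

namespace CycleField

/-! ### Laplace functionals of Poisson point processes -/

open Filter Topology

section ExpNeg

/-- The function `x ↦ exp (-x)` on `[0, ∞]`. -/
noncomputable def expNeg (x : ℝ≥0∞) : ℝ≥0∞ := (EReal.exp x)⁻¹

theorem one_le_exp_coe (x : ℝ≥0∞) : 1 ≤ EReal.exp (x : EReal) :=
  EReal.one_le_exp_iff.2 (EReal.coe_ennreal_nonneg x)

theorem expNeg_le_one (x : ℝ≥0∞) : expNeg x ≤ 1 := ENNReal.inv_le_one.2 (one_le_exp_coe x)

theorem expNeg_ne_top (x : ℝ≥0∞) : expNeg x ≠ ∞ :=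
  ((expNeg_le_one x).trans_lt ENNReal.one_lt_top).ne

theorem expNeg_zero : expNeg 0 = 1 := by simp [expNeg]

theorem expNeg_add (x y : ℝ≥0∞) : expNeg (x + y) = expNeg x * expNeg y := by
  rw [expNeg, EReal.coe_ennreal_add, EReal.exp_add, ENNReal.mul_inv]
  · rfl
  · exact Or.inl (zero_lt_one.trans_le (one_le_exp_coe x)).ne'
  · exact Or.inr (zero_lt_one.trans_le (one_le_exp_coe y)).ne'

theorem expNeg_sum {ι : Type*} (s : Finset ι) (f : ι → ℝ≥0∞) :
    expNeg (∑ i ∈ s, f i) = ∏ i ∈ s, expNeg (f i) := by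
  classical
  induction s using Finset.induction_on with
  | empty => simp [expNeg_zero]
  | insert i s hi ih => rw [Finset.sum_insert hi, Finset.prod_insert hi, expNeg_add, ih]

theorem expNeg_natCast_mul (n : ℕ) (x : ℝ≥0∞) : expNeg (n * x) = expNeg x ^ n := by
  induction n with
  | zero => simp [expNeg_zero]
  | succ n ih => rw [Nat.cast_succ, add_mul, one_mul, expNeg_add, ih, pow_succ]

theorem expNeg_injective : Function.Injective expNeg := by
  intro x y h
  have h1 := inv_injective h
  exact EReal.coe_ennreal_injective (EReal.exp_strictMono.injective h1)

theorem expNeg_ofReal {x : ℝ} (hx : 0 ≤ x) :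
    expNeg (ENNReal.ofReal x) = ENNReal.ofReal (Real.exp (-x)) := by
  rw [expNeg, EReal.coe_ennreal_ofReal, max_eq_left hx, EReal.exp_coe, Real.exp_neg,
    ENNReal.ofReal_inv_of_pos (Real.exp_pos _)]

theorem continuous_expNeg : Continuous expNeg :=
  continuous_inv.comp (ENNReal.continuous_exp.comp continuous_coe_ennreal_ereal)

@[fun_prop]
theorem measurable_expNeg : Measurable expNeg := continuous_expNeg.measurable

theorem expNeg_anti {x y : ℝ≥0∞} (h : x ≤ y) : expNeg y ≤ expNeg x :=
  ENNReal.inv_le_inv.2 (EReal.exp_monotone (EReal.coe_ennreal_le_coe_ennreal_iff.2 h))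

theorem expNeg_eq_one_iff {x : ℝ≥0∞} : expNeg x = 1 ↔ x = 0 := by
  rw [← expNeg_zero, expNeg_injective.eq_iff]

/-- The inverse of `expNeg` on `[0, 1]`. -/
noncomputable def negLog (y : ℝ≥0∞) : ℝ≥0∞ := (ENNReal.log y⁻¹).toENNReal

theorem expNeg_negLog {y : ℝ≥0∞} (hy : y ≤ 1) : expNeg (negLog y) = y := by
  rw [expNeg, negLog, EReal.coe_toENNReal, ENNReal.exp_log, inv_inv]
  simpa using hy

@[fun_prop]
theorem measurable_negLog : Measurable negLog :=
  measurable_ereal_toENNReal.comp (ENNReal.measurable_log.comp measurable_inv)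

end ExpNeg

/-! ### Laplace transforms determine measures -/

section Determinacy

open BoundedContinuousFunction

variable {ι : Type*}

/-- The coordinate function `x ↦ exp (-x i)` on `[0, ∞]^ι`. -/
noncomputable def expNegCoord (i : ι) : (ι → ℝ≥0∞) →ᵇ ℝ :=
  BoundedContinuousFunction.mkOfCompact
    ⟨fun x => (expNeg (x i)).toReal,
      ENNReal.continuousOn_toReal.comp_continuous
        (continuous_expNeg.comp (continuous_apply i)) fun _ => expNeg_ne_top _⟩

theorem expNegCoord_apply (i : ι) (x : ι → ℝ≥0∞) :
    expNegCoord i x = (expNeg (x i)).toReal := rfl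

/-- Finite measures on `[0, ∞]^ι` are determined by their Laplace transforms. -/
theorem ext_of_lintegral_prod_expNeg [Fintype ι] {μ ν : Measure (ι → ℝ≥0∞)} [IsFiniteMeasure μ]
    [IsFiniteMeasure ν]
    (h : ∀ k : ι → ℕ, ∫⁻ x, ∏ i, expNeg (x i) ^ k i ∂μ = ∫⁻ x, ∏ i, expNeg (x i) ^ k i ∂ν) :
    μ = ν := by
  classical
  -- This algebra separates points because `expNeg` is injective on all of `[0, ∞]`, and it is
  -- spanned by the monomials whose integrals agree by hypothesis.
  let A₀ : Subalgebra ℝ ((ι → ℝ≥0∞) →ᵇ ℝ) := Algebra.adjoin ℝ (Set.range expNegCoord)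
  have hstar : ∀ a : (ι → ℝ≥0∞) →ᵇ ℝ, star a = a := fun a => by ext x; simp
  let A : StarSubalgebra ℝ ((ι → ℝ≥0∞) →ᵇ ℝ) :=
    { A₀ with star_mem' := fun {a} ha => (hstar a).symm ▸ ha }
  refine ext_of_forall_mem_subalgebra_integral_eq_of_polish (𝕜 := ℝ) (A := A) ?_ ?_
  · intro x y hxy
    obtain ⟨i, hi⟩ := Function.ne_iff.1 hxy
    refine ⟨expNegCoord i, ⟨toContinuousMapStarₐ ℝ (expNegCoord i), ?_, rfl⟩, ?_⟩
    · exact ⟨expNegCoord i, Algebra.subset_adjoin ⟨i, rfl⟩, rfl⟩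
    · rw [expNegCoord_apply, expNegCoord_apply]
      intro h'
      exact hi (expNeg_injective
        ((ENNReal.toReal_eq_toReal_iff' (expNeg_ne_top _) (expNeg_ne_top _)).1 h'))
  · intro g hg
    have hg' : g ∈ Submodule.span ℝ ((Submonoid.closure (Set.range expNegCoord) :
        Submonoid ((ι → ℝ≥0∞) →ᵇ ℝ)) : Set ((ι → ℝ≥0∞) →ᵇ ℝ)) := by
      rw [← Algebra.adjoin_eq_span]; exact hg
    clear hg
    induction hg' using Submodule.span_induction with
    | mem g hg =>
      obtain ⟨k, hk⟩ : ∃ k : ι → ℕ, g = ∏ i, expNegCoord i ^ k i := by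
        obtain ⟨a, ha⟩ := Submonoid.mem_closure_range_iff.1 hg
        exact ⟨a, by rw [ha, Finsupp.prod_fintype]; simp⟩
      have hgx : ∀ x, g x = (∏ i, expNeg (x i) ^ k i).toReal := by
        intro x
        rw [hk, BoundedContinuousFunction.coe_prod, Finset.prod_apply, ENNReal.toReal_prod]
        simp [expNegCoord_apply]
      have hm : Measurable fun x : ι → ℝ≥0∞ => ∏ i, expNeg (x i) ^ k i := by fun_prop
      have hfin : ∀ x : ι → ℝ≥0∞, ∏ i, expNeg (x i) ^ k i < ∞ := fun x =>
        ENNReal.prod_lt_top fun i _ => ENNReal.pow_lt_top (expNeg_ne_top _).lt_top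
      simp only [hgx]
      rw [integral_toReal hm.aemeasurable (ae_of_all _ hfin),
        integral_toReal hm.aemeasurable (ae_of_all _ hfin), h]
    | zero => simp
    | add f g hf hg ihf ihg =>
      simp only [BoundedContinuousFunction.coe_add, Pi.add_apply]
      rw [integral_add (f.integrable μ) (g.integrable μ),
        integral_add (f.integrable ν) (g.integrable ν)]
      rw [ihf, ihg]
    | smul c f hf ihf =>
      simp only [BoundedContinuousFunction.coe_smul]
      rw [integral_smul, integral_smul, ihf]

end Determinacy

section PoissonLaw

instance isProbabilityMeasure_poissonLaw (m : ℝ≥0∞) : IsProbabilityMeasure (poissonLaw m) := by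
  unfold poissonLaw
  split_ifs
  · infer_instance
  · exact Measure.isProbabilityMeasure_map (by fun_prop)

theorem lintegral_expNeg_poissonLaw {c : ℝ≥0∞} (hc : c ≠ ∞) (m : ℝ≥0∞) :
    ∫⁻ x, expNeg (c * x) ∂poissonLaw m = expNeg ((1 - expNeg c) * m) := by
  unfold poissonLaw
  split_ifs with hm
  · rw [lintegral_dirac' _ (by fun_prop), hm]
    -- For infinite mean and `c ≠ 0` both exponents are infinite; for `c = 0` both vanish.
    by_cases h0 : c = 0
    · simp [h0, expNeg_zero]
    · rw [ENNReal.mul_top h0, ENNReal.mul_top]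
      rw [Ne, tsub_eq_zero_iff_le, not_le]
      exact lt_of_le_of_ne (expNeg_le_one c) fun h => h0 (expNeg_eq_one_iff.1 h)
  · lift m to ℝ≥0 using hm
    lift c to ℝ≥0 using hc
    rw [lintegral_map (by fun_prop) (by fun_prop), poissonMeasure, lintegral_sum_measure]
    simp only [lintegral_smul_measure, lintegral_dirac, ENNReal.toNNReal_coe, smul_eq_mul]
    have hq : expNeg c = ENNReal.ofReal (Real.exp (-c)) := by
      rw [← expNeg_ofReal c.coe_nonneg, ENNReal.ofReal_coe_nnreal]
    set q := Real.exp (-c) with hqdef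
    have hq0 : 0 ≤ q := (Real.exp_pos _).le
    have hq1 : q ≤ 1 := Real.exp_le_one_iff.2 (by simp)
    have h1 : ∀ n : ℕ, ENNReal.ofReal (Real.exp (-m) * m ^ n / n.factorial) *
        expNeg (c * n) = ENNReal.ofReal (Real.exp (-m) * ((m * q) ^ n / n.factorial)) := by
      intro n
      rw [mul_comm (c : ℝ≥0∞), expNeg_natCast_mul, hq, ← ENNReal.ofReal_pow hq0,
        ← ENNReal.ofReal_mul (by positivity)]
      congr 1
      rw [mul_pow]; ring
    have h2 : HasSum (fun n : ℕ => Real.exp (-m) * ((m * q) ^ n / n.factorial))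
        (Real.exp (-m) * Real.exp (m * q)) := by
      rw [Real.exp_eq_exp_ℝ]
      exact (NormedSpace.expSeries_div_hasSum_exp ((m : ℝ) * q)).mul_left _
    simp only [h1]
    rw [← ENNReal.ofReal_tsum_of_nonneg (fun n => by positivity) h2.summable, h2.tsum_eq, hq,
      ← ENNReal.ofReal_one, ← ENNReal.ofReal_sub _ hq0, ← ENNReal.ofReal_coe_nnreal,
      ← ENNReal.ofReal_mul (by linarith), expNeg_ofReal (mul_nonneg (by linarith) m.coe_nonneg),
      ← Real.exp_add]
    congr 2
    ring

end PoissonLaw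

/-! ### Laplace functionals characterize Poisson processes -/

section Laplace

variable {Ω E : Type*} [MeasurableSpace Ω] [MeasurableSpace E] {P : Measure Ω}
  {N : Ω → Measure E} {Λ : Measure E}

theorem IsPoissonPointProcess.indep_countable (hN : IsPoissonPointProcess P N Λ) {ι : Type*}
    [Countable ι] (B : ι → Set E) (hB : ∀ i, MeasurableSet (B i))
    (hd : Pairwise fun i j => Disjoint (B i) (B j)) :
    iIndepFun (fun i ω => N ω (B i)) P := by
  classical
  have := Encodable.ofCountable ι
  -- Numbers that encode no index get the empty set, so the family indexed by `ℕ` stays disjoint.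
  let C : ℕ → Set E := fun n => ⋃ (i : ι) (_ : Encodable.encode i = n), B i
  have hC : ∀ i, C (Encodable.encode i) = B i := by
    intro i; ext x; simp [C]
  have h1 := hN.indep C
    (fun n => MeasurableSet.iUnion fun i => MeasurableSet.iUnion fun _ => hB i) (by
      intro m n hmn
      simp only [C, Set.disjoint_iUnion_left, Set.disjoint_iUnion_right]
      rintro i rfl j rfl
      exact hd fun h => hmn (by rw [h]))
  have h2 := h1.precomp (Encodable.encode_injective (α := ι))
  simpa only [hC] using h2

/-- The level sets of `f` are disjoint, so their masses are independent Poisson variables and the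
expectation factorizes. -/
theorem IsPoissonPointProcess.lintegral_expNeg_simpleFunc (hN : IsPoissonPointProcess P N Λ)
    (f : SimpleFunc E ℝ≥0∞) (hf : ∀ x, f x ≠ ∞) :
    ∫⁻ ω, expNeg (∫⁻ x, f x ∂N ω) ∂P = expNeg (∫⁻ x, (1 - expNeg (f x)) ∂Λ) := by
  classical
  have h1 : ∀ ω, expNeg (∫⁻ x, f x ∂N ω) =
      ∏ c ∈ f.range.attach, expNeg (c.1 * N ω (f ⁻¹' {c.1})) := by
    intro ω
    rw [SimpleFunc.lintegral_eq_lintegral, SimpleFunc.lintegral, expNeg_sum,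
      ← Finset.prod_attach]
  have h2 : ∫⁻ x, (1 - expNeg (f x)) ∂Λ =
      ∑ c ∈ f.range.attach, (1 - expNeg c.1) * Λ (f ⁻¹' {c.1}) := by
    have : ∀ x, 1 - expNeg (f x) = f.map (fun c => 1 - expNeg c) x := fun x => rfl
    simp only [this]
    rw [SimpleFunc.lintegral_eq_lintegral, SimpleFunc.map_lintegral, ← Finset.sum_attach]
  have hm : ∀ c : f.range, MeasurableSet (f ⁻¹' {c.1}) := fun c => f.measurableSet_preimage _
  have hi : iIndepFun (fun (c : f.range) ω => N ω (f ⁻¹' {c.1})) P := by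
    refine hN.indep_countable _ hm fun c c' hcc => ?_
    refine Disjoint.preimage _ (Set.disjoint_singleton.2 fun h => hcc (Subtype.ext h))
  simp only [h1]
  rw [lintegral_prod_eq_prod_lintegral_of_indepFun f.range.attach
    (fun (c : f.range) ω => expNeg (c.1 * N ω (f ⁻¹' {c.1})))
    (hi.comp (fun c x => expNeg (c.1 * x)) fun c => by fun_prop)
    (fun c => measurable_expNeg.comp ((hN.measurable _ (hm c)).const_mul _)), h2, expNeg_sum]
  refine Finset.prod_congr rfl fun c _ => ?_
  have hc : c.1 ≠ ∞ := by
    obtain ⟨x, hx⟩ := SimpleFunc.mem_range.1 c.2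
    rw [← hx]; exact hf x
  rw [← lintegral_expNeg_poissonLaw hc, ← hN.law _ (hm c),
    lintegral_map (by fun_prop) (hN.measurable _ (hm c))]

theorem IsPoissonPointProcess.lintegral_expNeg [IsProbabilityMeasure P]
    (hN : IsPoissonPointProcess P N Λ) {f : E → ℝ≥0∞} (hf : Measurable f) :
    ∫⁻ ω, expNeg (∫⁻ x, f x ∂N ω) ∂P = expNeg (∫⁻ x, (1 - expNeg (f x)) ∂Λ) := by
  have hlim : ∀ μ : Measure E, Tendsto (fun n => ∫⁻ x, SimpleFunc.eapprox f n x ∂μ) atTop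
      (𝓝 (∫⁻ x, f x ∂μ)) := fun μ =>
    lintegral_tendsto_of_tendsto_of_monotone
      (fun n => (SimpleFunc.eapprox f n).measurable.aemeasurable)
      (ae_of_all _ fun x _ _ h => SimpleFunc.monotone_eapprox f h x)
      (ae_of_all _ fun x => SimpleFunc.tendsto_eapprox hf x)
  have hl : Tendsto (fun n => ∫⁻ ω, expNeg (∫⁻ x, SimpleFunc.eapprox f n x ∂N ω) ∂P) atTop
      (𝓝 (∫⁻ ω, expNeg (∫⁻ x, f x ∂N ω) ∂P)) := by
    refine tendsto_lintegral_of_dominated_convergence (fun _ => 1) (fun n => ?_)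
      (fun n => ae_of_all _ fun ω => expNeg_le_one _) (by simp)
      (ae_of_all _ fun ω => (continuous_expNeg.tendsto _).comp (hlim (N ω)))
    refine measurable_expNeg.comp ?_
    simp only [SimpleFunc.lintegral_eq_lintegral, SimpleFunc.lintegral]
    exact Finset.measurable_sum _ fun c _ =>
      (hN.measurable _ (SimpleFunc.measurableSet_preimage _ _)).const_mul _
  have hr : Tendsto (fun n => expNeg (∫⁻ x, (1 - expNeg (SimpleFunc.eapprox f n x)) ∂Λ)) atTop
      (𝓝 (expNeg (∫⁻ x, (1 - expNeg (f x)) ∂Λ))) := by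
    refine (continuous_expNeg.tendsto _).comp ?_
    refine lintegral_tendsto_of_tendsto_of_monotone (fun n => ?_) (ae_of_all _ fun x m n h => ?_)
      (ae_of_all _ fun x => ?_)
    · have := (SimpleFunc.eapprox f n).measurable
      fun_prop
    · exact tsub_le_tsub_left (expNeg_anti (SimpleFunc.monotone_eapprox f h x)) _
    · exact ENNReal.Tendsto.sub tendsto_const_nhds
        ((continuous_expNeg.tendsto _).comp (SimpleFunc.tendsto_eapprox hf x))
        (Or.inl ENNReal.one_ne_top)
  refine tendsto_nhds_unique hl (hr.congr fun n => ?_)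
  exact (hN.lintegral_expNeg_simpleFunc _ fun x => (SimpleFunc.eapprox_lt_top f n x).ne).symm

theorem one_sub_expNeg_sum_indicator {E ι : Type*} [Fintype ι] (B : ι → Set E)
    (hd : Pairwise fun i j => Disjoint (B i) (B j)) (k : ι → ℝ≥0∞) (x : E) :
    1 - expNeg (∑ i, (B i).indicator (fun _ => k i) x) =
      ∑ i, (B i).indicator (fun _ => 1 - expNeg (k i)) x := by
  by_cases hx : ∃ i, x ∈ B i
  · obtain ⟨i, hi⟩ := hx
    have hj : ∀ j, j ≠ i → x ∉ B j := fun j hj hxj => Set.disjoint_left.1 (hd hj) hxj hi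
    rw [Finset.sum_eq_single i, Finset.sum_eq_single i] <;> simp +contextual [hi, hj]
  · push Not at hx
    simp [hx, expNeg_zero]

/-- The test functions `∑ i, k i · 1_{B i}` with natural `k i` produce exactly the moments that
determine a law on `[0, ∞]^ι`. Since the `B i` are disjoint, the functional factorizes. -/
theorem map_pi_of_laplace [IsProbabilityMeasure P]
    (hm : ∀ B, MeasurableSet B → Measurable fun ω => N ω B)
    (hL : ∀ f : E → ℝ≥0∞, Measurable f →
      ∫⁻ ω, expNeg (∫⁻ x, f x ∂N ω) ∂P = expNeg (∫⁻ x, (1 - expNeg (f x)) ∂Λ))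
    {ι : Type*} [Fintype ι] (B : ι → Set E) (hB : ∀ i, MeasurableSet (B i))
    (hd : Pairwise fun i j => Disjoint (B i) (B j)) :
    P.map (fun ω i => N ω (B i)) = Measure.pi fun i => poissonLaw (Λ (B i)) := by
  have hmeas : Measurable fun ω i => N ω (B i) := measurable_pi_lambda _ fun i => hm _ (hB i)
  have : IsProbabilityMeasure (P.map fun ω i => N ω (B i)) :=
    Measure.isProbabilityMeasure_map hmeas.aemeasurable
  refine ext_of_lintegral_prod_expNeg fun k => ?_
  have hind : iIndepFun (fun i (x : ι → ℝ≥0∞) => expNeg (x i) ^ k i)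
      (Measure.pi fun i => poissonLaw (Λ (B i))) :=
    iIndepFun_pi (X := fun i (y : ℝ≥0∞) => expNeg y ^ k i) fun i => by fun_prop
  rw [lintegral_prod_eq_prod_lintegral_of_indepFun _ _ hind (fun i => by fun_prop),
    lintegral_map (by fun_prop) hmeas]
  have h1 : ∀ ω, ∏ i, expNeg (N ω (B i)) ^ k i =
      expNeg (∫⁻ x, ∑ i, (B i).indicator (fun _ => (k i : ℝ≥0∞)) x ∂N ω) := by
    intro ω
    rw [lintegral_finsetSum _ fun i _ => measurable_const.indicator (hB i), expNeg_sum]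
    refine Finset.prod_congr rfl fun i _ => ?_
    rw [lintegral_indicator_const (hB i), expNeg_natCast_mul]
  simp only [h1]
  rw [hL _ (Finset.measurable_sum _ fun i _ => measurable_const.indicator (hB i))]
  simp only [one_sub_expNeg_sum_indicator B hd]
  rw [lintegral_finsetSum _ fun i _ => measurable_const.indicator (hB i), expNeg_sum]
  refine Finset.prod_congr rfl fun i _ => ?_
  rw [lintegral_indicator_const (hB i), ← lintegral_expNeg_poissonLaw (ENNReal.natCast_ne_top _),
    ← (measurePreserving_eval (fun i => poissonLaw (Λ (B i))) i).lintegral_comp (by fun_prop)]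
  simp only [expNeg_natCast_mul, Function.eval]

/-- A random measure is a Poisson point process if it has the Laplace functional of one. -/
theorem isPoissonPointProcess_of_laplace [IsProbabilityMeasure P]
    (hm : ∀ B, MeasurableSet B → Measurable fun ω => N ω B)
    (hL : ∀ f : E → ℝ≥0∞, Measurable f →
      ∫⁻ ω, expNeg (∫⁻ x, f x ∂N ω) ∂P = expNeg (∫⁻ x, (1 - expNeg (f x)) ∂Λ)) :
    IsPoissonPointProcess P N Λ := by
  have hlaw : ∀ B, MeasurableSet B → P.map (fun ω => N ω B) = poissonLaw (Λ B) := by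
    intro B hB
    have h1 := map_pi_of_laplace hm hL (fun _ : Unit => B) (fun _ => hB)
      (fun i j h => absurd rfl h)
    have h2 := congrArg (Measure.map (Function.eval ())) h1
    rwa [(measurePreserving_eval (fun _ : Unit => poissonLaw (Λ B)) ()).map_eq,
      Measure.map_map (measurable_pi_apply _) (measurable_pi_lambda _ fun _ => hm _ hB)] at h2
  refine ⟨hm, hlaw, fun B hB hd => ?_⟩
  rw [iIndepFun_iff_finset]
  intro s
  refine (iIndepFun_iff_map_fun_eq_pi_map (f := s.restrict fun i ω => N ω (B i))
    fun i => (hm _ (hB _)).aemeasurable).2 ?_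
  have h1 := map_pi_of_laplace hm hL (fun i : s => B i) (fun i => hB i)
    (fun i j h => hd fun h' => h (Subtype.ext h'))
  have h2 : ∀ i : s, P.map (s.restrict (fun i ω => N ω (B i)) i) = poissonLaw (Λ (B i)) :=
    fun i => hlaw _ (hB i)
  simp only [h2]
  exact h1

end Laplace

end CycleField

namespace CycleField

/-! ### Marked Poisson point processes -/

section Marking

open Filter Topology

variable {Ω E S : Type*} [MeasurableSpace Ω] [MeasurableSpace E]

theorem measurable_comp_countable [Countable S] {ξ : Ω → E} {Z : Ω → S} (hξ : Measurable ξ)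
    (hZ : ∀ y, MeasurableSet {ω | Z ω = y}) {g : E → S → ℝ≥0∞} (hg : ∀ y, Measurable (g · y)) :
    Measurable fun ω => g (ξ ω) (Z ω) := by
  classical
  have : (fun ω => g (ξ ω) (Z ω)) =
      fun ω => ∑' y, {ω | Z ω = y}.indicator (fun ω => g (ξ ω) y) ω := by
    ext ω
    rw [tsum_eq_single (Z ω)]
    · simp
    · intro y hy
      simp [hy.symm]
  rw [this]
  exact Measurable.tsum fun y => ((hg y).comp hξ).indicator (hZ y)

/-- Given the sequence `ξ`, the marks `Z n` are independent, and `Z n` has the mass function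
`κ (ξ n)`. -/
structure IsMarking (P : Measure Ω) (ξ : ℕ → Ω → E) (Z : ℕ → Ω → S) (κ : E → S → ℝ≥0∞) :
    Prop where
  measurable_point : ∀ n, Measurable (ξ n)
  measurable_mark : ∀ n y, MeasurableSet {ω | Z n ω = y}
  measurable_kernel : ∀ y, Measurable (κ · y)
  law : ∀ A : Set (ℕ → E), MeasurableSet A → ∀ (I : Finset ℕ) (y : ℕ → S),
    P {ω | (fun n => ξ n ω) ∈ A ∧ ∀ n ∈ I, Z n ω = y n} =
      ∫⁻ ω in {ω | (fun n => ξ n ω) ∈ A}, ∏ n ∈ I, κ (ξ n ω) (y n) ∂P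

variable {P : Measure Ω} {ξ : ℕ → Ω → E} {Z : ℕ → Ω → S} {κ : E → S → ℝ≥0∞}

namespace IsMarking

theorem measurableSet_marks (h : IsMarking P ξ Z κ) (I : Finset ℕ) (y : ℕ → S) :
    MeasurableSet {ω | ∀ n ∈ I, Z n ω = y n} := by
  have : {ω | ∀ n ∈ I, Z n ω = y n} = ⋂ n ∈ I, {ω | Z n ω = y n} := by ext; simp
  rw [this]
  exact Finset.measurableSet_biInter _ fun n _ => h.measurable_mark n _

/-- The law of the marks says that two measures on sequences of points agree on every measurable
`A`; hence they integrate every `H` alike. -/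
theorem setLIntegral_marks (h : IsMarking P ξ Z κ) {H : (ℕ → E) → ℝ≥0∞} (hH : Measurable H)
    (I : Finset ℕ) (y : ℕ → S) :
    ∫⁻ ω in {ω | ∀ n ∈ I, Z n ω = y n}, H (fun n => ξ n ω) ∂P =
      ∫⁻ ω, H (fun n => ξ n ω) * ∏ n ∈ I, κ (ξ n ω) (y n) ∂P := by
  have hξ : Measurable fun ω n => ξ n ω := measurable_pi_lambda _ h.measurable_point
  have hκ : Measurable fun ω => ∏ n ∈ I, κ (ξ n ω) (y n) :=
    Finset.measurable_prod _ fun n _ => (h.measurable_kernel _).comp (h.measurable_point n)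
  have key : (P.restrict {ω | ∀ n ∈ I, Z n ω = y n}).map (fun ω n => ξ n ω) =
      (P.withDensity fun ω => ∏ n ∈ I, κ (ξ n ω) (y n)).map (fun ω n => ξ n ω) := by
    ext A hA
    rw [Measure.map_apply hξ hA, Measure.map_apply hξ hA, Measure.restrict_apply (hξ hA),
      withDensity_apply _ (hξ hA)]
    exact h.law A hA I y
  have h1 := congrArg (fun μ => ∫⁻ x, H x ∂μ) key
  simp only [lintegral_map hH hξ] at h1
  refine h1.trans ((lintegral_withDensity_eq_lintegral_mul P hκ (hH.comp hξ)).trans ?_)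
  exact lintegral_congr fun ω => mul_comm _ _

theorem setLIntegral_prod_marks [Countable S] (h : IsMarking P ξ Z κ) {G : E → S → ℝ≥0∞}
    (hG : ∀ y, Measurable (G · y)) (J : Finset ℕ) :
    ∀ {H : (ℕ → E) → ℝ≥0∞}, Measurable H → ∀ (I : Finset ℕ) (y : ℕ → S), Disjoint I J →
      ∫⁻ ω in {ω | ∀ n ∈ I, Z n ω = y n}, H (fun n => ξ n ω) * ∏ n ∈ J, G (ξ n ω) (Z n ω) ∂P =
        ∫⁻ ω, H (fun n => ξ n ω) * (∏ n ∈ I, κ (ξ n ω) (y n)) *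
          ∏ n ∈ J, ∑' z, κ (ξ n ω) z * G (ξ n ω) z ∂P := by
  classical
  induction J using Finset.induction_on with
  | empty =>
    intro H hH I y _
    simpa using h.setLIntegral_marks hH I y
  | insert j J hj ih =>
    intro H hH I y hIJ
    rw [Finset.disjoint_insert_right] at hIJ
    obtain ⟨hjI, hIJ⟩ := hIJ
    -- Splitting by the value `z` of `Z j` moves `j` from `J` into `I` and makes `G (ξ j) z` a
    -- function of the points alone, which joins `H`.
    have hset : {ω | ∀ n ∈ I, Z n ω = y n} =
        ⋃ z, {ω | ∀ n ∈ insert j I, Z n ω = Function.update y j z n} := by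
      ext ω
      simp only [Set.mem_ofPred_eq, Set.mem_iUnion, Finset.forall_mem_insert,
        Function.update_self]
      have : ∀ z, (∀ n ∈ I, Z n ω = Function.update y j z n) ↔ ∀ n ∈ I, Z n ω = y n := by
        intro z
        refine forall₂_congr fun n hn => ?_
        rw [Function.update_of_ne (show n ≠ j from fun hnj => hjI (hnj ▸ hn))]
      simp [this]
    have hξ : Measurable fun ω n => ξ n ω := measurable_pi_lambda _ h.measurable_point
    have hκG : Measurable fun x => ∑' z, κ x z * G x z :=
      Measurable.tsum fun z => (h.measurable_kernel z).mul (hG z)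
    rw [hset, lintegral_iUnion fun z => h.measurableSet_marks _ _]
    · have hterm : ∀ z, ∫⁻ ω in {ω | ∀ n ∈ insert j I, Z n ω = Function.update y j z n},
          H (fun n => ξ n ω) * ∏ n ∈ insert j J, G (ξ n ω) (Z n ω) ∂P =
          ∫⁻ ω, H (fun n => ξ n ω) * (∏ n ∈ I, κ (ξ n ω) (y n)) *
            (∏ n ∈ J, ∑' z, κ (ξ n ω) z * G (ξ n ω) z) * (κ (ξ j ω) z * G (ξ j ω) z) ∂P := by
        intro z
        have hH' : Measurable fun x : ℕ → E => H x * G (x j) z :=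
          hH.mul ((hG z).comp (measurable_pi_apply j))
        have h1 := ih hH' (insert j I) (Function.update y j z)
          (Finset.disjoint_insert_left.2 ⟨hj, hIJ⟩)
        calc _ = ∫⁻ ω in {ω | ∀ n ∈ insert j I, Z n ω = Function.update y j z n},
              H (fun n => ξ n ω) * G (ξ j ω) z * ∏ n ∈ J, G (ξ n ω) (Z n ω) ∂P := by
              refine setLIntegral_congr_fun (h.measurableSet_marks _ _) fun ω hω => ?_
              have hz : Z j ω = z := by
                simpa using hω j (Finset.mem_insert_self _ _)
              rw [Finset.prod_insert hj, hz, mul_assoc]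
          _ = _ := h1
          _ = _ := by
              refine lintegral_congr fun ω => ?_
              have hp : ∏ n ∈ I, κ (ξ n ω) (Function.update y j z n) =
                  ∏ n ∈ I, κ (ξ n ω) (y n) := Finset.prod_congr rfl fun n hn => by
                rw [Function.update_of_ne (show n ≠ j from fun hnj => hjI (hnj ▸ hn))]
              rw [Finset.prod_insert hjI, hp, Function.update_self]
              ring
      simp only [hterm]
      rw [← lintegral_tsum]
      · refine lintegral_congr fun ω => ?_
        rw [ENNReal.tsum_mul_left, Finset.prod_insert hj]
        ring
      · intro z
        refine Measurable.aemeasurable ?_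
        refine (((hH.comp hξ).mul (Finset.measurable_prod _ fun n _ =>
          (h.measurable_kernel _).comp (h.measurable_point n))).mul
            (Finset.measurable_prod _ fun n _ => hκG.comp (h.measurable_point n))).mul ?_
        exact ((h.measurable_kernel z).mul (hG z)).comp (h.measurable_point j)
    · intro z z' hzz
      rw [Function.onFun, Set.disjoint_left]
      intro ω hω hω'
      have h1 := hω j (Finset.mem_insert_self _ _)
      have h2 := hω' j (Finset.mem_insert_self _ _)
      rw [Function.update_self] at h1 h2
      exact hzz (h1.symm.trans h2)

theorem lintegral_mul_prod_marks [Countable S] (h : IsMarking P ξ Z κ) {G : E → S → ℝ≥0∞}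
    (hG : ∀ y, Measurable (G · y)) (J : Finset ℕ) {H : (ℕ → E) → ℝ≥0∞} (hH : Measurable H) :
    ∫⁻ ω, H (fun n => ξ n ω) * ∏ n ∈ J, G (ξ n ω) (Z n ω) ∂P =
      ∫⁻ ω, H (fun n => ξ n ω) * ∏ n ∈ J, ∑' z, κ (ξ n ω) z * G (ξ n ω) z ∂P := by
  rcases isEmpty_or_nonempty Ω with hΩ | ⟨⟨ω₀⟩⟩
  · simp [Measure.eq_zero_of_isEmpty P]
  -- With `I` empty the prescribed marks are irrelevant; a sample point merely supplies some
  -- sequence in `S`.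
  · simpa using h.setLIntegral_prod_marks hG J hH ∅ (fun n => Z n ω₀) (by simp)

/-- Every mark has some value in the countable set `S`, so no mass is lost. For the halving chain
this replaces a separate proof that it does not explode. -/
theorem tsum_kernel_eq_one [Countable S] [IsProbabilityMeasure P] (h : IsMarking P ξ Z κ) (n : ℕ) :
    ∀ᵐ ω ∂P, ∑' z, κ (ξ n ω) z = 1 := by
  have hκ : Measurable fun x => ∑' z, κ x z := Measurable.tsum fun z => h.measurable_kernel z
  have hP : IsProbabilityMeasure (P.map (ξ n)) :=
    Measure.isProbabilityMeasure_map (h.measurable_point n).aemeasurable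
  have key : (fun x => ∑' z, κ x z) =ᵐ[P.map (ξ n)] fun _ => 1 := by
    refine ae_eq_of_forall_setLIntegral_eq_of_sigmaFinite hκ measurable_const fun A hA _ => ?_
    have h1 := h.lintegral_mul_prod_marks (G := fun _ _ => 1) (fun _ => measurable_const) {n}
      (H := fun x => A.indicator 1 (x n))
      ((measurable_one.indicator hA).comp (measurable_pi_apply n))
    simp only [Finset.prod_const_one, mul_one, Finset.prod_singleton] at h1
    rw [← lintegral_indicator hA, ← lintegral_indicator hA,
      lintegral_map (hκ.indicator hA) (h.measurable_point n),
      lintegral_map (measurable_const.indicator hA) (h.measurable_point n)]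
    refine Eq.trans ?_ (h1.symm.trans ?_)
    · refine lintegral_congr fun ω => ?_
      by_cases hω : ξ n ω ∈ A <;> simp [hω]
    · rfl
  exact ae_of_ae_map (h.measurable_point n).aemeasurable key

end IsMarking

/-- Transfers a property holding almost surely at all points of the process to `Λ`-almost every
point. -/
theorem IsPoissonPointProcess.measure_eq_zero {N : Ω → Measure E} {Λ : Measure E}
    [IsProbabilityMeasure P] (hN : IsPoissonPointProcess P N Λ) {B : Set E}
    (hB : MeasurableSet B) (h : ∀ᵐ ω ∂P, N ω B = 0) : Λ B = 0 := by
  have h1 := lintegral_expNeg_poissonLaw ENNReal.one_ne_top (Λ B)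
  rw [← hN.law B hB, lintegral_map (by fun_prop) (hN.measurable B hB)] at h1
  have h2 : ∫⁻ ω, expNeg (1 * N ω B) ∂P = 1 := by
    rw [lintegral_congr_ae (h.mono fun ω hω => by
      show expNeg (1 * N ω B) = 1
      rw [hω, mul_zero, expNeg_zero])]
    simp
  rw [h2] at h1
  have h3 := expNeg_eq_one_iff.1 h1.symm
  refine (mul_eq_zero.1 h3).resolve_left ?_
  rw [tsub_eq_zero_iff_le, not_le]
  exact lt_of_le_of_ne (expNeg_le_one 1) fun h' => one_ne_zero (expNeg_eq_one_iff.1 h')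

theorem tendsto_prod_expNeg (a : ℕ → ℝ≥0∞) :
    Tendsto (fun m => ∏ n ∈ Finset.range m, expNeg (a n)) atTop (𝓝 (expNeg (∑' n, a n))) := by
  simp only [← expNeg_sum]
  exact (continuous_expNeg.tendsto _).comp ENNReal.summable.hasSum.tendsto_sum_nat

theorem lintegral_sum_dirac_eq {Ω : Type*} (ξ : ℕ → Ω → E) {f : E → ℝ≥0∞}
    (hf : Measurable f) (ω : Ω) :
    ∫⁻ x, f x ∂(Measure.sum fun n => Measure.dirac (ξ n ω)) = ∑' n, f (ξ n ω) := by
  rw [lintegral_sum_measure]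
  exact tsum_congr fun n => lintegral_dirac' _ hf

/-- The Laplace functional of a marked Poisson point process. -/
theorem IsMarking.lintegral_expNeg [Countable S] [IsProbabilityMeasure P] (h : IsMarking P ξ Z κ)
    {Λ : Measure E}
    (hN : IsPoissonPointProcess P (fun ω => Measure.sum fun n => Measure.dirac (ξ n ω)) Λ)
    {f : E → S → ℝ≥0∞} (hf : ∀ y, Measurable (f · y)) :
    ∫⁻ ω, expNeg (∑' n, f (ξ n ω) (Z n ω)) ∂P =
      expNeg (∫⁻ x, ∑' y, κ x y * (1 - expNeg (f x y)) ∂Λ) := by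
  -- Conditional expectation of `e^{-f}` given the point. Writing it as `expNeg (negLog F)` reduces
  -- the marked functional to that of the unmarked process.
  set F : E → ℝ≥0∞ := fun x => ∑' y, κ x y * expNeg (f x y) with hF
  have hFm : Measurable F := Measurable.tsum fun y =>
    (h.measurable_kernel y).mul (measurable_expNeg.comp (hf y))
  have hF1 : ∀ x, ∑' y, κ x y = 1 → F x ≤ 1 := by
    intro x hx
    rw [← hx]
    exact ENNReal.tsum_le_tsum fun y => mul_le_of_le_one_right' (expNeg_le_one _)
  have hae : ∀ᵐ ω ∂P, ∀ n, ∑' z, κ (ξ n ω) z = 1 := ae_all_iff.2 h.tsum_kernel_eq_one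
  have hΛ : ∀ᵐ x ∂Λ, ∑' z, κ x z = 1 := by
    have hm : MeasurableSet {x | ¬ ∑' z, κ x z = 1} :=
      (measurableSet_eq_fun (Measurable.tsum fun z => h.measurable_kernel z)
        measurable_const).compl
    refine ae_iff.2 (hN.measure_eq_zero hm (hae.mono fun ω hω => ?_))
    rw [Measure.sum_apply _ hm, ENNReal.tsum_eq_zero]
    intro n
    rw [Measure.dirac_apply' _ hm, Set.indicator_of_notMem]
    simpa using hω n
  have hmeas : ∀ n, Measurable fun ω => expNeg (f (ξ n ω) (Z n ω)) := fun n =>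
    measurable_expNeg.comp (measurable_comp_countable (h.measurable_point n)
      (h.measurable_mark n) hf)
  have h1 : Tendsto (fun m => ∫⁻ ω, ∏ n ∈ Finset.range m, expNeg (f (ξ n ω) (Z n ω)) ∂P) atTop
      (𝓝 (∫⁻ ω, expNeg (∑' n, f (ξ n ω) (Z n ω)) ∂P)) :=
    tendsto_lintegral_of_dominated_convergence (fun _ => 1)
      (fun m => Finset.measurable_prod _ fun n _ => hmeas n)
      (fun m => ae_of_all _ fun ω => Finset.prod_le_one' fun n _ => expNeg_le_one _)
      (by simp) (ae_of_all _ fun ω => tendsto_prod_expNeg _)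
  have h2 : Tendsto (fun m => ∫⁻ ω, ∏ n ∈ Finset.range m, expNeg (negLog (F (ξ n ω))) ∂P) atTop
      (𝓝 (∫⁻ ω, expNeg (∑' n, negLog (F (ξ n ω))) ∂P)) :=
    tendsto_lintegral_of_dominated_convergence (fun _ => 1)
      (fun m => Finset.measurable_prod _ fun n _ =>
        measurable_expNeg.comp (measurable_negLog.comp (hFm.comp (h.measurable_point n))))
      (fun m => ae_of_all _ fun ω => Finset.prod_le_one' fun n _ => expNeg_le_one _)
      (by simp) (ae_of_all _ fun ω => tendsto_prod_expNeg _)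
  have h3 : ∀ m, ∫⁻ ω, ∏ n ∈ Finset.range m, expNeg (f (ξ n ω) (Z n ω)) ∂P =
      ∫⁻ ω, ∏ n ∈ Finset.range m, expNeg (negLog (F (ξ n ω))) ∂P := by
    intro m
    have h4 := h.lintegral_mul_prod_marks (G := fun x y => expNeg (f x y))
      (fun y => measurable_expNeg.comp (hf y)) (Finset.range m) (H := fun _ => 1) measurable_const
    simp only [one_mul] at h4
    rw [h4]
    refine lintegral_congr_ae (hae.mono fun ω hω => ?_)
    exact Finset.prod_congr rfl fun n _ => (expNeg_negLog (hF1 _ (hω n))).symm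
  simp only [h3] at h1
  rw [tendsto_nhds_unique h1 h2]
  have hnF : Measurable fun x => negLog (F x) := measurable_negLog.comp hFm
  have h5 := hN.lintegral_expNeg hnF
  simp only [lintegral_sum_dirac_eq ξ hnF] at h5
  rw [h5]
  congr 1
  refine lintegral_congr_ae (hΛ.mono fun x hx => ?_)
  show 1 - expNeg (negLog (F x)) = ∑' y, κ x y * (1 - expNeg (f x y))
  rw [expNeg_negLog (hF1 x hx)]
  have h6 : F x + ∑' y, κ x y * (1 - expNeg (f x y)) = 1 := by
    refine Eq.trans ?_ hx
    rw [hF, ← ENNReal.tsum_add]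
    refine tsum_congr fun y => ?_
    rw [← mul_add, add_tsub_cancel_of_le (expNeg_le_one _), mul_one]
  exact ENNReal.sub_eq_of_eq_add_rev ((hF1 x hx).trans_lt ENNReal.one_lt_top).ne h6.symm

end Marking

end CycleField

namespace CycleField

/-! ### The intensity of the limiting process -/

section HalfLine

theorem measurableEmbedding_nnreal_coe : MeasurableEmbedding ((↑) : ℝ≥0 → ℝ) :=
  MeasurableEmbedding.subtype_coe measurableSet_Ici

instance sigmaFinite_comap_nnreal_coe :
    SigmaFinite ((volume : Measure ℝ).comap ((↑) : ℝ≥0 → ℝ)) := by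
  refine SigmaFinite.of_map _ measurableEmbedding_nnreal_coe.measurable.aemeasurable ?_
  rw [measurableEmbedding_nnreal_coe.map_comap]
  infer_instance

theorem measurable_exponentialPDF (r : ℝ) : Measurable (exponentialPDF r) :=
  (measurable_exponentialPDFReal r).ennreal_ofReal

theorem comap_expMeasure (r : ℝ) : (expMeasure r).comap ((↑) : ℝ≥0 → ℝ) =
    ((volume : Measure ℝ).comap ((↑) : ℝ≥0 → ℝ)).withDensity fun v => exponentialPDF r v := by
  have hemb := measurableEmbedding_nnreal_coe
  ext A hA
  have hA' : MeasurableSet (((↑) : ℝ≥0 → ℝ) '' A) := hemb.measurableSet_image.2 hA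
  rw [hemb.comap_apply, withDensity_apply _ hA, ← lintegral_indicator hA]
  have h1 : ∀ v : ℝ≥0, A.indicator (fun v : ℝ≥0 => exponentialPDF r v) v =
      (((↑) : ℝ≥0 → ℝ) '' A).indicator (exponentialPDF r) (v : ℝ) := by
    intro v
    by_cases hv : v ∈ A <;> simp [hv]
  simp only [h1]
  rw [← hemb.lintegral_map (μ := (volume : Measure ℝ).comap ((↑) : ℝ≥0 → ℝ)), hemb.map_comap,
    lintegral_indicator hA', Measure.restrict_restrict_of_subset (Set.image_subset_range _ _)]
  exact withDensity_apply _ hA'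

instance sFinite_comap_expMeasure (r : ℝ) :
    SFinite ((expMeasure r).comap ((↑) : ℝ≥0 → ℝ)) := by
  rw [comap_expMeasure]; infer_instance

theorem comap_expMeasure_Ici {r : ℝ} (hr : 0 < r) (v : ℝ≥0) :
    (expMeasure r).comap ((↑) : ℝ≥0 → ℝ) (Set.Ici v) = ENNReal.ofReal (Real.exp (-(r * v))) := by
  have himg : ((↑) : ℝ≥0 → ℝ) '' Set.Ici v = Set.Ici (v : ℝ) := by
    ext x
    constructor
    · rintro ⟨y, hy, rfl⟩; exact NNReal.coe_le_coe.2 hy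
    · intro hx
      exact ⟨⟨x, v.coe_nonneg.trans hx⟩, hx, rfl⟩
  have := isProbabilityMeasure_expMeasure hr
  have hac : expMeasure r ≪ volume := withDensity_absolutelyContinuous _ _
  have h1 : Set.Ici (v : ℝ) =ᵐ[expMeasure r] Set.Ioi (v : ℝ) :=
    hac.ae_le (Ioi_ae_eq_Ici (μ := volume)).symm
  rw [measurableEmbedding_nnreal_coe.comap_apply, himg, measure_congr h1, ← Set.compl_Iic,
    prob_compl_eq_one_sub measurableSet_Iic, ← ofReal_cdf, cdf_expMeasure_eq hr,
    if_pos v.coe_nonneg, ← ENNReal.ofReal_one, ← ENNReal.ofReal_sub]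
  · congr 1; ring
  · have : Real.exp (-(r * v)) ≤ 1 :=
      Real.exp_le_one_iff.2 (neg_nonpos.2 (mul_nonneg hr.le v.coe_nonneg))
    linarith

end HalfLine

section Intensity

variable {d : ℕ}

theorem lintegral_chiIntensity {g : Atom d → ℝ≥0∞} (hg : Measurable g) :
    ∫⁻ x, g x ∂chiIntensity d = ∑' w : WordClass d, ENNReal.ofReal (2 * w.b / w.h) *
      ∫⁻ z, ∫⁻ v, g (z, v, w) ∂((expMeasure (2 * w.b)).comap ((↑) : ℝ≥0 → ℝ)) := by
  rw [chiIntensity, lintegral_sum_measure]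
  refine tsum_congr fun w => ?_
  rw [lintegral_prod _ hg.aemeasurable, ← lintegral_const_mul']
  swap
  · exact ENNReal.ofReal_ne_top
  refine lintegral_congr fun z => ?_
  have hgz : Measurable fun p : ℝ≥0 × WordClass d => g (z, p) := hg.comp measurable_prodMk_left
  rw [lintegral_prod _ hgz.aemeasurable, ← lintegral_const_mul']
  swap
  · exact ENNReal.ofReal_ne_top
  refine lintegral_congr fun v => ?_
  rw [lintegral_smul_measure, lintegral_dirac]
  rfl

theorem measurable_of_forall_word {α β : Type*} [MeasurableSpace α] [MeasurableSpace β]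
    {g : α × WordClass d → β} (hg : ∀ w, Measurable fun a => g (a, w)) : Measurable g :=
  measurable_from_prod_countable_left hg

/-- The density of the image of `chiIntensity` when the word is moved according to `κ`. -/
noncomputable def movedDensity (κ : WordClass d → WordClass d → ℝ≥0∞)
    (p : ℝ≥0 × WordClass d) : ℝ≥0∞ :=
  ∑' w : WordClass d, ENNReal.ofReal (2 * w.b / w.h) * κ w p.2 * exponentialPDF (2 * w.b) p.1

theorem measurable_movedDensity (κ : WordClass d → WordClass d → ℝ≥0∞) :
    Measurable (movedDensity κ) := by
  refine measurable_of_forall_word fun w' => Measurable.tsum fun w => ?_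
  have h1 : Measurable fun v : ℝ≥0 => exponentialPDF (2 * w.b) v :=
    (measurable_exponentialPDF _).comp measurableEmbedding_nnreal_coe.measurable
  exact h1.const_mul (ENNReal.ofReal (2 * w.b / w.h) * κ w w')

/-- The weighted reference measure is the image of `chiIntensity` under `κ`; the identity is
Tonelli's theorem after inserting the exponential density. -/
theorem lintegral_movedDensity (κ : WordClass d → WordClass d → ℝ≥0∞) {g : Atom d → ℝ≥0∞}
    (hg : Measurable g) :
    ∫⁻ x, g x ∂(refMeasure d).withDensity (fun a => movedDensity κ a.2) =
      ∫⁻ x, ∑' w', κ x.2.2 w' * g (x.1, x.2.1, w') ∂chiIntensity d := by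
  have hρ : Measurable fun a : Atom d => movedDensity κ a.2 :=
    (measurable_movedDensity κ).comp measurable_snd
  have hpdf : ∀ r : ℝ, Measurable fun v : ℝ≥0 => exponentialPDF r v := fun r =>
    (measurable_exponentialPDF r).comp measurableEmbedding_nnreal_coe.measurable
  have hgw : ∀ w', Measurable fun p : ℝ × ℝ≥0 => g (p.1, p.2, w') := fun w' => by fun_prop
  have hsum : Measurable fun x : Atom d => ∑' w', κ x.2.2 w' * g (x.1, x.2.1, w') := by
    refine Measurable.tsum fun w' => Measurable.mul ?_ (by fun_prop)
    exact (measurable_of_countable fun w => κ w w').comp (measurable_snd.comp measurable_snd)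
  rw [lintegral_withDensity_eq_lintegral_mul _ hρ hg, lintegral_chiIntensity hsum, refMeasure,
    lintegral_prod _ (hρ.mul hg).aemeasurable]
  have h1 : ∀ z : ℝ, ∫⁻ p : ℝ≥0 × WordClass d, ((fun a : Atom d => movedDensity κ a.2) * g) (z, p)
        ∂((volume : Measure ℝ).comap ((↑) : ℝ≥0 → ℝ)).prod Measure.count =
      ∑' w : WordClass d, ENNReal.ofReal (2 * w.b / w.h) *
        ∫⁻ v, ∑' w', κ w w' * g (z, v, w')
          ∂((expMeasure (2 * w.b)).comap ((↑) : ℝ≥0 → ℝ)) := by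
    intro z
    have hgz : ∀ w', Measurable fun v : ℝ≥0 => g (z, v, w') := fun w' => by fun_prop
    have hgs : ∀ w, Measurable fun v : ℝ≥0 => ∑' w', κ w w' * g (z, v, w') := fun w =>
      Measurable.tsum fun w' => (hgz w').const_mul _
    have hρgz : Measurable fun p : ℝ≥0 × WordClass d =>
        ((fun a : Atom d => movedDensity κ a.2) * g) (z, p) :=
      (hρ.mul hg).comp measurable_prodMk_left
    rw [lintegral_prod _ hρgz.aemeasurable]
    have h2 : ∀ w : WordClass d, ENNReal.ofReal (2 * w.b / w.h) *
        ∫⁻ v, ∑' w', κ w w' * g (z, v, w')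
          ∂((expMeasure (2 * w.b)).comap ((↑) : ℝ≥0 → ℝ)) =
        ∫⁻ v, ENNReal.ofReal (2 * w.b / w.h) * (exponentialPDF (2 * w.b) v *
          ∑' w', κ w w' * g (z, v, w')) ∂((volume : Measure ℝ).comap ((↑) : ℝ≥0 → ℝ)) := by
      intro w
      rw [comap_expMeasure, lintegral_withDensity_eq_lintegral_mul _ (hpdf _) (hgs w),
        lintegral_const_mul' _ _ ENNReal.ofReal_ne_top]
      rfl
    simp only [h2]
    have h3 : ∀ w : WordClass d, Measurable fun v : ℝ≥0 => ENNReal.ofReal (2 * w.b / w.h) *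
        (exponentialPDF (2 * w.b) v * ∑' w', κ w w' * g (z, v, w')) := fun w =>
      ((hpdf _).mul (hgs w)).const_mul _
    rw [← lintegral_tsum fun w => (h3 w).aemeasurable]
    refine lintegral_congr fun v => ?_
    rw [lintegral_count]
    simp only [Pi.mul_apply, movedDensity, ← ENNReal.tsum_mul_left, ← ENNReal.tsum_mul_right]
    rw [ENNReal.tsum_comm]
    exact tsum_congr fun w => tsum_congr fun w' => by ring
  simp only [h1]
  rw [lintegral_tsum]
  · refine tsum_congr fun w => ?_
    rw [lintegral_const_mul' _ _ ENNReal.ofReal_ne_top]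
  · intro w
    refine (Measurable.const_mul ?_ _).aemeasurable
    have : Measurable fun p : ℝ × ℝ≥0 => ∑' w', κ w w' * g (p.1, p.2, w') :=
      Measurable.tsum fun w' => (hgw w').const_mul _
    exact this.lintegral_prod_right'

theorem withDensity_movedDensity_apply (κ : WordClass d → WordClass d → ℝ≥0∞) {B : Set ℝ}
    (hB : MeasurableSet B) (v : ℝ≥0) (w' : WordClass d) :
    (refMeasure d).withDensity (fun a => movedDensity κ a.2) (B ×ˢ Set.Ici v ×ˢ {w'}) =
      volume B * ∑' w : WordClass d, ENNReal.ofReal (2 * w.b / w.h) * κ w w' *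
        ENNReal.ofReal (Real.exp (-2 * w.b * v)) := by
  classical
  have hS : MeasurableSet (B ×ˢ Set.Ici v ×ˢ ({w'} : Set (WordClass d))) :=
    hB.prod (measurableSet_Ici.prod (measurableSet_singleton w'))
  rw [← lintegral_indicator_one hS, lintegral_movedDensity κ (measurable_one.indicator hS)]
  have h1 : ∀ x : Atom d, ∑' w'', κ x.2.2 w'' *
      (B ×ˢ Set.Ici v ×ˢ ({w'} : Set (WordClass d))).indicator 1 (x.1, x.2.1, w'') =
      κ x.2.2 w' * (B.indicator 1 x.1 * (Set.Ici v).indicator 1 x.2.1) := by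
    intro x
    rw [tsum_eq_single w']
    · by_cases hx : x.1 ∈ B <;> by_cases hv : v ≤ x.2.1 <;> simp [hx, hv, Set.indicator]
    · intro w'' hw
      simp [Set.indicator, hw]
  simp only [h1]
  have hBm : Measurable (B.indicator (1 : ℝ → ℝ≥0∞)) := measurable_one.indicator hB
  have hvm : Measurable ((Set.Ici v).indicator (1 : ℝ≥0 → ℝ≥0∞)) :=
    measurable_one.indicator measurableSet_Ici
  have hκ : Measurable fun x : Atom d => κ x.2.2 w' :=
    (measurable_of_countable fun w => κ w w').comp (measurable_snd.comp measurable_snd)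
  have hg : Measurable fun x : Atom d =>
      κ x.2.2 w' * (B.indicator 1 x.1 * (Set.Ici v).indicator 1 x.2.1) :=
    hκ.mul ((hBm.comp measurable_fst).mul (hvm.comp (measurable_fst.comp measurable_snd)))
  rw [lintegral_chiIntensity hg, ← ENNReal.tsum_mul_left]
  refine tsum_congr fun w => ?_
  have h2 : ∫⁻ z, ∫⁻ u, κ w w' * (B.indicator 1 z * (Set.Ici v).indicator 1 u)
      ∂((expMeasure (2 * w.b)).comap ((↑) : ℝ≥0 → ℝ)) =
      κ w w' * (volume B * (expMeasure (2 * w.b)).comap ((↑) : ℝ≥0 → ℝ) (Set.Ici v)) := by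
    have h3 : ∀ z : ℝ, ∫⁻ u, κ w w' * (B.indicator 1 z * (Set.Ici v).indicator 1 u)
        ∂((expMeasure (2 * w.b)).comap ((↑) : ℝ≥0 → ℝ)) =
        κ w w' * (B.indicator 1 z *
          (expMeasure (2 * w.b)).comap ((↑) : ℝ≥0 → ℝ) (Set.Ici v)) := by
      intro z
      rw [lintegral_const_mul _ (hvm.const_mul _), lintegral_const_mul _ hvm,
        lintegral_indicator_one measurableSet_Ici]
    simp only [h3]
    rw [lintegral_const_mul _ (hBm.mul_const _), lintegral_mul_const _ hBm,
      lintegral_indicator_one hB]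
  refine (congrArg _ h2).trans ?_
  -- For `b(w) = 0` the exponential tail formula is unavailable, but the prefactor `2 b(w) / h(w)`
  -- vanishes.
  rcases Nat.eq_zero_or_pos w.b with hb | hb
  · simp [hb]
  · rw [comap_expMeasure_Ici (by positivity)]
    have : -(2 * (w.b : ℝ) * v) = -2 * w.b * v := by ring
    rw [this]
    ring

end Intensity

/-! ### Expectations over the doubling chain -/

section DoublingChain

variable {d : ℕ} {Ω' : Type*} [MeasurableSpace Ω'] {Q : WordClass d → Measure Ω'}
  {Y : ℝ≥0 → Ω' → WordClass d}

theorem measurable_doublingChain {w : WordClass d}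
    (hY : IsMarkovChain (Q w) doublingRate w Y) (s : ℝ≥0) : Measurable (Y s) :=
  measurable_to_countable' fun y => hY.measurable s y

theorem lintegral_doublingChain {w : WordClass d}
    (hY : IsMarkovChain (Q w) doublingRate w Y) (s : ℝ≥0) (φ : WordClass d → ℝ≥0∞) :
    ∫⁻ ω, φ (Y s ω) ∂Q w = ∑' y, transProb doublingRate s w y * φ y := by
  have hm := measurable_doublingChain hY s
  rw [← lintegral_map (measurable_of_countable φ) hm, lintegral_countable']
  refine tsum_congr fun y => ?_
  rw [Measure.map_apply hm (measurableSet_singleton y), mul_comm]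
  congr 1
  have h1 := hY.law [(s, y)]
  simp only [Visits, visitProb, zero_add, and_true, mul_one] at h1
  exact h1

/-- Each doubling raises both `b` and the length by one, so words violating the identity have
transition probability zero. -/
theorem ae_doublingChain {w : WordClass d}
    (hY : IsMarkovChain (Q w) doublingRate w Y) (s : ℝ≥0) :
    ∀ᵐ ω ∂Q w, ((Y s ω).b : ℝ) = (Y s ω).len + (w.b - w.len) := by
  classical
  have h1 := lintegral_doublingChain hY s
    (fun y => if y.b + w.len = y.len + w.b then 0 else 1)
  have h2 : ∑' y, transProb doublingRate s w y *
      (if y.b + w.len = y.len + w.b then 0 else 1) = 0 := by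
    rw [ENNReal.tsum_eq_zero]
    intro y
    by_cases h0 : transProb doublingRate s w y = 0
    · simp [h0]
    · rw [if_pos (of_transProb_doubling_ne_zero s.coe_nonneg h0), mul_zero]
  have hm : Measurable fun ω =>
      if (Y s ω).b + w.len = (Y s ω).len + w.b then (0 : ℝ≥0∞) else 1 :=
    (measurable_of_countable fun y : WordClass d =>
      if y.b + w.len = y.len + w.b then (0 : ℝ≥0∞) else 1).comp (measurable_doublingChain hY s)
  rw [h2, lintegral_eq_zero_iff hm] at h1
  filter_upwards [h1] with ω hω
  have h3 : (Y s ω).b + w.len = (Y s ω).len + w.b := by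
    by_contra hne
    simp [hne] at hω
  have h4 : ((Y s ω).b : ℝ) + w.len = (Y s ω).len + w.b := by exact_mod_cast h3
  linarith

theorem lintegral_len_doublingChain {w : WordClass d}
    (hY : IsMarkovChain (Q w) doublingRate w Y) (s : ℝ≥0) :
    ∫⁻ ω, ENNReal.ofReal (Y s ω).len ∂Q w = ENNReal.ofReal (w.len * Real.exp s) := by
  rw [lintegral_doublingChain hY s fun y => ENNReal.ofReal y.len,
    ← tsum_transProb_doubling_mul_len s.coe_nonneg]
  simp

theorem integrable_len_doublingChain {w : WordClass d}
    (hY : IsMarkovChain (Q w) doublingRate w Y) (s : ℝ≥0) :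
    Integrable (fun ω => ((Y s ω).len : ℝ)) (Q w) := by
  refine ⟨((measurable_of_countable fun y : WordClass d => (y.len : ℝ)).comp
    (measurable_doublingChain hY s)).aestronglyMeasurable, ?_⟩
  rw [hasFiniteIntegral_iff_ofReal (ae_of_all _ fun ω => Nat.cast_nonneg _),
    lintegral_len_doublingChain hY s]
  exact ENNReal.ofReal_lt_top

theorem integrable_b_mul_exp {w : WordClass d}
    (hY : IsMarkovChain (Q w) doublingRate w Y) (s v : ℝ≥0) :
    Integrable (fun ω => ((Y s ω).b : ℝ) * Real.exp (-2 * (Y s ω).b * (v : ℝ))) (Q w) := by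
  refine (integrable_len_doublingChain hY s).mono' ?_ (ae_of_all _ fun ω => ?_)
  · exact ((measurable_of_countable fun y : WordClass d =>
      (y.b : ℝ) * Real.exp (-2 * y.b * (v : ℝ))).comp
        (measurable_doublingChain hY s)).aestronglyMeasurable
  · have h1 : Real.exp (-2 * (Y s ω).b * (v : ℝ)) ≤ 1 := by
      rw [Real.exp_le_one_iff]
      have : 0 ≤ ((Y s ω).b : ℝ) * v := by positivity
      linarith
    have h2 : ((Y s ω).b : ℝ) ≤ (Y s ω).len := by exact_mod_cast (Y s ω).b_le_len
    rw [Real.norm_of_nonneg (by positivity)]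
    calc ((Y s ω).b : ℝ) * Real.exp (-2 * (Y s ω).b * (v : ℝ)) ≤ (Y s ω).b * 1 := by gcongr
      _ ≤ (Y s ω).len := by linarith

theorem integral_b_doublingChain [∀ w, IsProbabilityMeasure (Q w)] {w : WordClass d}
    (hY : IsMarkovChain (Q w) doublingRate w Y) (s : ℝ≥0) :
    ∫ ω, ((Y s ω).b : ℝ) ∂Q w = w.b - w.len + Real.exp s * w.len := by
  rw [integral_congr_ae (ae_doublingChain hY s),
    integral_add (integrable_len_doublingChain hY s) (integrable_const _), integral_const,
    integral_eq_lintegral_of_nonneg_ae (ae_of_all _ fun ω => Nat.cast_nonneg _)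
      (integrable_len_doublingChain hY s).1, lintegral_len_doublingChain hY s,
    ENNReal.toReal_ofReal (by positivity)]
  simp
  ring

theorem ofReal_rate {t : ℝ} (ht : t ≤ 0) {w' : WordClass d}
    (hY : IsMarkovChain (Q w') doublingRate w' Y) (v : ℝ≥0) :
    ENNReal.ofReal (rate Q Y t v w') = ∑' w : WordClass d, ENNReal.ofReal (2 * w.b / w.h) *
      transProb halvingRate (-t) (some w) (some w') *
        ENNReal.ofReal (Real.exp (-2 * w.b * v)) := by
  have hs : (((-t).toNNReal : ℝ≥0) : ℝ) = -t := Real.coe_toNNReal _ (by linarith)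
  rw [rate, ENNReal.ofReal_mul (by positivity), ofReal_integral_eq_lintegral_ofReal
    (integrable_b_mul_exp hY _ v) (ae_of_all _ fun ω => by positivity),
    lintegral_doublingChain hY (-t).toNNReal
      fun y => ENNReal.ofReal (y.b * Real.exp (-2 * y.b * (v : ℝ))),
    ← ENNReal.tsum_mul_left, hs]
  refine tsum_congr fun w => ?_
  -- A factor `h(w̄)` is split off to apply the duality; the resulting `h(w)` then cancels the
  -- denominator.
  have h1 : ENNReal.ofReal (2 * w.b / w.h) =
      ENNReal.ofReal (2 * w.b / (w.h * w'.h)) * w'.h := by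
    have := w'.h_pos
    have := w.h_pos
    rw [← ENNReal.ofReal_natCast, ← ENNReal.ofReal_mul (by positivity)]
    congr 1
    field_simp
  have h2 : ENNReal.ofReal (2 * w.b / (w.h * w'.h)) * w.h =
      ENNReal.ofReal (2 / w'.h) * ENNReal.ofReal w.b := by
    have := w'.h_pos
    have := w.h_pos
    rw [← ENNReal.ofReal_natCast w.h, ← ENNReal.ofReal_mul (by positivity),
      ← ENNReal.ofReal_mul (by positivity)]
    congr 1
    field_simp
  rw [h1, mul_assoc (ENNReal.ofReal _) (w'.h : ℝ≥0∞), transProb_duality (by linarith),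
    ← mul_assoc (ENNReal.ofReal _) (w.h : ℝ≥0∞), h2, ENNReal.ofReal_mul (Nat.cast_nonneg _)]
  ring

end DoublingChain

/-! ### The process at a fixed time as a marked Poisson process -/

section LimitingProcess

variable {d : ℕ} {Ω : Type*} [MeasurableSpace Ω] {P : Measure Ω} {ξ : ℕ → Ω → Atom d}
  {X : ℕ → ℝ≥0 → Ω → Option (WordClass d)}

theorem IsLimitingProcess.isMarking (hX : IsLimitingProcess P ξ X) (s : ℝ≥0) :
    IsMarking P ξ (fun n => X n s) fun x y => transProb halvingRate s (some x.2.2) y where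
  measurable_point := hX.measurable_atom
  measurable_mark n y := hX.measurable_chain n s y
  measurable_kernel y := (measurable_of_countable fun w : WordClass d =>
    transProb halvingRate s (some w) y).comp (measurable_snd.comp measurable_snd)
  law A hA I y := by
    have := hX.law A hA I fun n => [(s, y n)]
    simpa [Visits, visitProb] using this

/-- The value of a function of atoms at the atom obtained from `x` by replacing its word, and
`0` if there is no word left. -/
def movedValue (f : Atom d → ℝ≥0∞) (x : Atom d) : Option (WordClass d) → ℝ≥0∞
  | some w' => f (x.1, x.2.1, w')
  | none => 0

theorem measurable_movedValue {f : Atom d → ℝ≥0∞} (hf : Measurable f)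
    (y : Option (WordClass d)) : Measurable fun x => movedValue f x y := by
  cases y with
  | none => exact measurable_const
  | some w' => unfold movedValue; fun_prop

theorem lintegral_chiAt {Ω : Type*} {ξ : ℕ → Ω → Atom d}
    {X : ℕ → ℝ≥0 → Ω → Option (WordClass d)} {f : Atom d → ℝ≥0∞} (hf : Measurable f) (t : ℝ) (ω : Ω) :
    ∫⁻ a, f a ∂chiAt ξ X t ω = ∑' n, movedValue f (ξ n ω) (X n (-t).toNNReal ω) := by
  rw [chiAt, lintegral_sum_measure]
  refine tsum_congr fun n => ?_
  cases X n (-t).toNNReal ω with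
  | none => simp [movedValue]
  | some w' => simp only [movedValue]; rw [lintegral_dirac' _ hf]

theorem IsLimitingProcess.isPoissonPointProcess_chiAt [IsProbabilityMeasure P]
    (hX : IsLimitingProcess P ξ X) {t : ℝ} (ht : t ≤ 0) :
    IsPoissonPointProcess P (chiAt ξ X t) ((refMeasure d).withDensity fun a =>
      movedDensity (fun w w' => transProb halvingRate (-t) (some w) (some w')) a.2) := by
  have hs : (((-t).toNNReal : ℝ≥0) : ℝ) = -t := Real.coe_toNNReal _ (by linarith)
  have hM := hX.isMarking (-t).toNNReal
  refine isPoissonPointProcess_of_laplace (fun B hB => ?_) fun f hf => ?_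
  · have h1 : ∀ ω, chiAt ξ X t ω B =
        ∑' n, movedValue (B.indicator 1) (ξ n ω) (X n (-t).toNNReal ω) := fun ω => by
      rw [← lintegral_indicator_one hB, lintegral_chiAt (measurable_one.indicator hB)]
    simp only [h1]
    exact Measurable.tsum fun n => measurable_comp_countable (hM.measurable_point n)
      (hM.measurable_mark n) (measurable_movedValue (measurable_one.indicator hB))
  · simp only [lintegral_chiAt hf]
    have hf' : Measurable fun x => 1 - expNeg (f x) := by fun_prop
    rw [hM.lintegral_expNeg hX.poisson (measurable_movedValue hf), lintegral_movedDensity _ hf']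
    -- The term of `Δ` is `1 - e^0 = 0`: killed atoms drop out of the intensity.
    simp only [tsum_option_eq, movedValue, expNeg_zero, tsub_self, mul_zero, zero_add, hs]

end LimitingProcess

end CycleField

open CycleField in
theorem proposition10 (d : ℕ) {Ω Ω' : Type*} [MeasurableSpace Ω] [MeasurableSpace Ω']
    (P : Measure Ω) [IsProbabilityMeasure P]
    (ξ : ℕ → Ω → Atom d) (X : ℕ → ℝ≥0 → Ω → Option (WordClass d))
    (hX : IsLimitingProcess P ξ X)
    (Q : WordClass d → Measure Ω') [∀ w, IsProbabilityMeasure (Q w)]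
    (Y : ℝ≥0 → Ω' → WordClass d)
    (hY : ∀ w, IsMarkovChain (Q w) doublingRate w Y)
    (t : ℝ) (ht : t ≤ 0) :
    -- the point process is Poisson; its intensity has a density that is constant in `z`
    (∃ ρ : ℝ≥0 × WordClass d → ℝ≥0∞, Measurable ρ ∧
      IsPoissonPointProcess P (chiAt ξ X t) ((refMeasure d).withDensity fun a => ρ a.2) ∧
      -- the mass that the intensity gives to births in `B`, lifetimes in `[v, ∞)` and word `w`
      ∀ (B : Set ℝ) (v : ℝ≥0) (w : WordClass d), MeasurableSet B →
        (refMeasure d).withDensity (fun a => ρ a.2) (B ×ˢ Set.Ici v ×ˢ {w}) =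
          volume B * ENNReal.ofReal (rate Q Y t v w)) ∧
    -- the expectation that defines the rate is that of an integrable variable
    (∀ (v : ℝ≥0) (w : WordClass d),
      Integrable (fun ω => ((Y (-t).toNNReal ω).b : ℝ) *
        Real.exp (-2 * (Y (-t).toNNReal ω).b * (v : ℝ))) (Q w)) ∧
    -- the birth rate
    ∀ w : WordClass d, rate Q Y t 0 w =
      2 / (w.h : ℝ) * ((w.b : ℝ) - w.len + Real.exp (-t) * w.len) := by
  refine ⟨⟨_, measurable_movedDensity _, hX.isPoissonPointProcess_chiAt ht, ?_⟩,
    fun v w => integrable_b_mul_exp (hY w) _ v, fun w => ?_⟩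
  · intro B v w hB
    rw [withDensity_movedDensity_apply _ hB, ofReal_rate ht (hY w)]
  · have hs : (((-t).toNNReal : ℝ≥0) : ℝ) = -t := Real.coe_toNNReal _ (by linarith)
    simp only [rate, mul_zero, Real.exp_zero, mul_one]
    rw [integral_b_doublingChain (hY w), hs]
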